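/- Let $L,N\ge 1$ be integers, $\beta\ge 0$ an integer, and let $\nu$ be a $\sigma$-finite Borel measure on $\mathbb R$ such that $$Z_N=\frac1{N!}\int_{\mathbb R^N}\prod_{1\le m<n\le N}|\lambda_n-\lambda_m|^{\beta}\,d\nu^N(\lambda)$$ satisfies $0<Z_N<\infty$. Let $\mathbf p=(p_1,\dots,p_{NL})$ be any family of real monic polynomials with $\deg p_n=n-1$. Write $\mathbf e_1,\dots,\mathbf e_d$ for the standard basis of $\mathbb R^d$. For a strictly increasing $\mathfrak t:\{1,\dots,L\}\to\{1,\dots,NL\}$ put $\epsilon_{\mathfrak t}=\mathbf e_{\mathfrak t(1)}\wedge\cdots\wedge\mathbf e_{\mathfrak t(L)}$ and $$\mathrm{Wr}(\mathbf p_{\mathfrak t};x)=\det\Big[\tfrac1{(\ell-1)!}\,p_{\mathfrak t(n)}^{(\ell-1)}(x)\Big]_{n,\ell=1}^{L},\qquad \omega(x)=\sum_{\mathfrak t}\mathrm{Wr}(\mathbf p_{\mathfrak t};x)\,\epsilon_{\mathfrak t}\in\Lambda^L(\mathbb R^{NL}).$$ For a $k$-form $\alpha\in\Lambda^k(\mathbb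 R^{mk})$, $k\ge1$, the hyperpfaffian $\mathrm{PF}(\alpha)\in\mathbb R$ is defined by $\frac1{m!}\alpha^{\wedge m}=\mathrm{PF}(\alpha)\,\mathbf e_1\wedge\cdots\wedge\mathbf e_{mk}$. Integrals of form-valued functions are taken coefficientwise with respect to the standard basis of basic forms, and $\mathrm{sgn}(0)=0$. Let $\epsilon'=\mathbf e_{NL+1}\wedge\cdots\wedge\mathbf e_{NL+L}\in\Lambda^L(\mathbb R^{(N+1)L})$, and regard forms on $\mathbb R^{NL}$ as forms on $\mathbb R^{(N+1)L}$ through $\mathbf e_i\mapsto\mathbf e_i$. Then, in each of the following cases, all the integrals on the right-hand side converge absolutely, and: 1. if $\beta=L^2$ is even, $$Z_N=\mathrm{PF}\Big(\int_{\mathbb R}\omega(x)\,d\nu(x)\Big);$$ 2. if $\beta=L^2$ is odd and $N$ is even, $$Z_N=\mathrm{PF}\Big(\tfrac12\int_{\mathbb R}\int_{\mathbb R}\omega(x)\wedge\omega(y)\,\mathrm{sgn}(y-x)\,d\nu(x)\,d\nu(y)\Big);$$ 3. if $\beta=L^2$ is odd and $N$ is odd, $$Z_N=\mathrm{PF}\Big(\tfrac12\int_{\mathbb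 R}\int_{\mathbb R}\omega(x)\wedge\omega(y)\,\mathrm{sgn}(y-x)\,d\nu(x)\,d\nu(y)+\int_{\mathbb R}\omega(x)\wedge\epsilon'\,d\nu(x)\Big),$$ the hyperpfaffian being that of a $2L$-form on $\mathbb R^{(N+1)L}$; 4. if $\beta=L^2+1$ is even and $N=2M$ is even, $$Z_N=\mathrm{PF}\Big(\tfrac12\int_{\mathbb R}\int_{\mathbb R}\omega(x)\wedge\omega(y)\,\frac{(y^M-x^M)^2}{y-x}\,d\nu(x)\,d\nu(y)\Big),$$ where the quotient, a polynomial in $x,y$, is $0$ for $x=y$. -/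

import Mathlib

open MeasureTheory

noncomputable section

namespace HyperPf

/-- The space `Λ^k(ℝ^n)` of `k`-forms (`k`-vectors) over `ℝ^n`. -/
abbrev Form (n k : ℕ) : Type := ⋀[ℝ]^k (Fin n → ℝ)

/-- The standard basis vector `e_i` of `ℝ^n` (indices start at `0`). -/
def e {n : ℕ} (i : Fin n) : Fin n → ℝ := Pi.single i 1

/-- The basic form `e_{t(0)} ∧ e_{t(1)} ∧ ⋯ ∧ e_{t(k-1)}`. -/
def basicForm {n k : ℕ} (t : Fin k → Fin n) : Form n k :=
  exteriorPower.ιMulti ℝ k fun i => e (t i)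

/-- The exterior product of a `j`-form and a `k`-form. -/
def wedge {n j k : ℕ} (a : Form n j) (b : Form n k) : Form n (j + k) :=
  ⟨(a : ExteriorAlgebra ℝ (Fin n → ℝ)) * (b : ExteriorAlgebra ℝ (Fin n → ℝ)),
    SetLike.mul_mem_graded a.2 b.2⟩

/-- The volume form `e_0 ∧ e_1 ∧ ⋯ ∧ e_{n-1}` of `ℝ^n`. -/
def volForm (n : ℕ) : ExteriorAlgebra ℝ (Fin n → ℝ) :=
  ExteriorAlgebra.ιMulti ℝ n fun i : Fin n => e i

/-- The coefficient of the volume form in an element of the exterior algebra of `ℝ^n`: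
the linear functional that is `det` in degree `n` and `0` in all other degrees. -/
def volCoeff (n : ℕ) : ExteriorAlgebra ℝ (Fin n → ℝ) →ₗ[ℝ] ℝ :=
  ExteriorAlgebra.liftAlternating (Pi.single n Matrix.detRowAlternating)

/-- The hyperpfaffian of a `k`-form on `ℝ^n`, where `n = m * k`: the coefficient of the volume
form in `ω^{∧ m} / m!`; see `hyperpfaffian_spec`. -/
def hyperpfaffian {n k : ℕ} (ω : Form n k) : ℝ :=
  volCoeff n (((n / k).factorial : ℝ)⁻¹ • (ω : ExteriorAlgebra ℝ (Fin n → ℝ)) ^ (n / k))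

theorem volCoeff_volForm (n : ℕ) : volCoeff n (volForm n) = 1 := by
  unfold volCoeff volForm
  rw [ExteriorAlgebra.liftAlternating_apply_ιMulti, Pi.single_eq_same]
  have h : (fun i : Fin n => e i) = (1 : Matrix (Fin n) (Fin n) ℝ) := by
    ext i j
    simp [e, Matrix.one_apply, Pi.single_apply, eq_comm]
  rw [h]
  exact Matrix.det_one

theorem eq_volCoeff_smul {n : ℕ} {a : ExteriorAlgebra ℝ (Fin n → ℝ)}
    (ha : a ∈ ⋀[ℝ]^n (Fin n → ℝ)) : a = volCoeff n a • volForm n := by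
  rw [← ExteriorAlgebra.ιMulti_span_fixedDegree] at ha
  induction ha using Submodule.span_induction with
  | mem x hx =>
    obtain ⟨v, rfl⟩ := hx
    let A : (Fin n → ℝ) [⋀^Fin n]→ₗ[ℝ] ExteriorAlgebra ℝ (Fin n → ℝ) :=
      ExteriorAlgebra.ιMulti ℝ n
    let B : (Fin n → ℝ) [⋀^Fin n]→ₗ[ℝ] ExteriorAlgebra ℝ (Fin n → ℝ) :=
      (((volCoeff n).smulRight (volForm n))).compAlternatingMap (ExteriorAlgebra.ιMulti ℝ n)
    have hAB : A = B := by
      refine Module.Basis.ext_alternating (Pi.basisFun ℝ (Fin n)) fun i hi => ?_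
      let σ : Equiv.Perm (Fin n) := Equiv.ofBijective i (Finite.injective_iff_bijective.1 hi)
      have hv : (fun j => Pi.basisFun ℝ (Fin n) (i j)) = (fun j : Fin n => e j) ∘ σ := by
        funext j
        simp [σ, e]
      have h1 : A (fun j : Fin n => e j) = volForm n := rfl
      have h2 : B (fun j : Fin n => e j) = volForm n := by
        change volCoeff n (volForm n) • volForm n = volForm n
        rw [volCoeff_volForm, one_smul]
      rw [hv, AlternatingMap.map_perm, AlternatingMap.map_perm, h1, h2]
    exact congrArg (fun f => f v) hAB
  | zero => simp
  | add x y _ _ hx hy => rw [map_add, add_smul, ← hx, ← hy]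
  | smul c x _ hx => rw [map_smul, smul_assoc, ← hx]

/-- The defining property of the hyperpfaffian: `ω^{∧ m} / m! = PF(ω) · ε_vol`. -/
theorem hyperpfaffian_spec {n k m : ℕ} (hk : 0 < k) (hn : n = m * k) (ω : Form n k) :
    ((m.factorial : ℝ)⁻¹ • (ω : ExteriorAlgebra ℝ (Fin n → ℝ)) ^ m) =
      hyperpfaffian ω • volForm n := by
  have hm : n / k = m := by rw [hn]; exact Nat.mul_div_cancel _ hk
  have hmem : (ω : ExteriorAlgebra ℝ (Fin n → ℝ)) ^ m ∈ ⋀[ℝ]^n (Fin n → ℝ) := by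
    have h := SetLike.pow_mem_graded (A := fun i : ℕ => ⋀[ℝ]^i (Fin n → ℝ)) m ω.2
    rwa [smul_eq_mul, ← hn] at h
  unfold hyperpfaffian
  rw [hm]
  exact eq_volCoeff_smul (Submodule.smul_mem _ _ hmem)

/-- The basis `{ε_t}` of `Λ^k(ℝ^n)` formed by the increasing `k`-fold products of the `e_i`. -/
def formBasis (n k : ℕ) : Module.Basis (Set.powersetCard (Fin n) k) ℝ (Form n k) :=
  (Pi.basisFun ℝ (Fin n)).exteriorPower k

/-- A form-valued function is integrable if all its coefficient functions are. -/
def FormIntegrable {X : Type*} [MeasurableSpace X] {n k : ℕ} (μ : Measure X)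
    (F : X → Form n k) : Prop :=
  ∀ s, Integrable (fun x => (formBasis n k).repr (F x) s) μ

/-- The form with constant coefficients obtained by integrating the coefficients of `F`. -/
def formIntegral {X : Type*} [MeasurableSpace X] {n k : ℕ} (μ : Measure X)
    (F : X → Form n k) : Form n k :=
  (formBasis n k).equivFun.symm fun s => ∫ x, (formBasis n k).repr (F x) s ∂μ

/-- The normalized Wronskian `det [ p_{t(i)}^{(ℓ)}(x) / ℓ! ]_{i,ℓ}`, `0 ≤ ℓ < L`. -/
def wronskian {n L : ℕ} (p : Fin n → Polynomial ℝ) (t : Fin L → Fin n) (x : ℝ) : ℝ :=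
  Matrix.det (Matrix.of fun i l : Fin L =>
    ((l : ℕ).factorial : ℝ)⁻¹ * (Polynomial.derivative^[(l : ℕ)] (p (t i))).eval x)

/-- A complete family of monic polynomials: `p_i` is monic of degree `i`, for `0 ≤ i < n`. -/
def IsCompleteMonic {n : ℕ} (p : Fin n → Polynomial ℝ) : Prop :=
  ∀ i, (p i).Monic ∧ (p i).natDegree = (i : ℕ)

/-- The `L`-form `ω(x) = ∑_t Wr(p_t; x) ε_t`, over all increasing `t`. -/
def omega {n : ℕ} (L : ℕ) (p : Fin n → Polynomial ℝ) (x : ℝ) : Form n L :=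
  ∑ t : Fin L ↪o Fin n, wronskian p t x • basicForm t

/-- `Λ^k(ℝ^{NL}) → Λ^k(ℝ^{(N+1)L})`, induced by the inclusion `e_i ↦ e_i`. -/
def extendForm (N L : ℕ) {k : ℕ} : Form (N * L) k →ₗ[ℝ] Form ((N + 1) * L) k :=
  exteriorPower.map k (Function.ExtendByZero.linearMap ℝ
    (Fin.castLE (Nat.mul_le_mul_right L (Nat.le_succ N)) : Fin (N * L) → Fin ((N + 1) * L)))

/-- The form `ε' = e_{NL+1} ∧ ⋯ ∧ e_{NL+L}` on `ℝ^{(N+1)L}` (in indices starting at `1`). -/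
def borderForm (N L : ℕ) : Form ((N + 1) * L) L :=
  basicForm fun j : Fin L => ⟨N * L + j, by rw [Nat.succ_mul]; exact Nat.add_lt_add_left j.2 _⟩

/-- The partition function `Z_N = (1/N!) ∫ ∏_{m<n} |λ_n - λ_m|^β dν^N(λ)`, in `[0,∞]`. -/
def partitionFunction (N β : ℕ) (ν : Measure ℝ) : ENNReal :=
  (N.factorial : ENNReal)⁻¹ *
    ∫⁻ x : Fin N → ℝ, ENNReal.ofReal (∏ m, ∏ n ∈ Finset.Ioi m, |x n - x m| ^ β)
      ∂(Measure.pi fun _ => ν)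

/-- The integrand `k(x,y) ω(x) ∧ ω(y)` of the double integrals. -/
def pairForm {n : ℕ} (L : ℕ) (p : Fin n → Polynomial ℝ) (k : ℝ → ℝ → ℝ) (x y : ℝ) :
    Form n (L + L) :=
  k x y • wedge (omega L p x) (omega L p y)

/-- The `2L`-form `½ ∫ ∫ ω(x) ∧ ω(y) k(x,y) dν(x) dν(y)`. -/
def doubleForm {n : ℕ} (L : ℕ) (p : Fin n → Polynomial ℝ) (k : ℝ → ℝ → ℝ) (ν : Measure ℝ) :
    Form n (L + L) :=
  (1 / 2 : ℝ) • formIntegral ν fun y => formIntegral ν fun x => pairForm L p k x y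

end HyperPf

end

/-!
Grouping the rows by points, the coefficient of `ω(x₁) ∧ ⋯ ∧ ω(x_N)` along the volume form is the
confluent Vandermonde determinant `∏_{m<n} (x_n - x_m)^{L²}`: each `ω(x)` is the decomposable form
spanned by the vectors of Taylor coefficients of `p` at `x`, and by monicity `p` may be exchanged
for the Hermite–Newton basis, which makes the matrix triangular. Powers of integrated forms are
integrals over product spaces, so for even `L²` this is the first formula.

For odd `L²` the determinant is antisymmetric in `x`, so a weight `k(x₁, x₂) k(x₃, x₄) ⋯` in front
of it may be antisymmetrized. That antisymmetrization is itself read off the `M`-th power of the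
`2`-form `∑_{i,j} k(x_i, x_j) v_i ∧ v_j`: it is `2^M M!` times the sign of the Vandermonde
determinant for `k = sgn(y - x)`, and `2^M M!` times the determinant itself for
`k = (y^M - x^M)² / (y - x)`, the form being then `2 ∑_{a < M} u_a ∧ u_{2M-1-a}` with
`u_a = ∑_i x_i^a v_i`. For odd `N`, the form `∫ ω ∧ ε'` squares to zero, so exactly one unpaired
factor `ω(x)` enters the top power.

Convergence: fixing all variables but one in the finite integral `Z_N` at a generic point with
distinct coordinates, Cramer's rule shows that `ν` has finite moments up to order `β (N - 1)`, and
the Wronskians have degree at most `L² (N - 1)`.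
-/

noncomputable section

namespace HyperPf

section ConfluentVandermonde

open Polynomial

variable {R : Type*} [CommRing R]

theorem det_functional_eq_of_monic {n : ℕ} (φ : Fin n → R[X] →ₗ[R] R) {p q : Fin n → R[X]}
    (hp : ∀ i, (p i).natDegree = i) (hp' : ∀ i, (p i).Monic)
    (hq : ∀ i, (q i).natDegree = i) (hq' : ∀ i, (q i).Monic) :
    (Matrix.of fun r i => φ r (p i)).det = (Matrix.of fun r i => φ r (q i)).det := by
  have eq_monomials {f : Fin n → R[X]} (hf : ∀ i, (f i).natDegree = i) (hf' : ∀ i, (f i).Monic) :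
      (Matrix.of fun r i => φ r (f i)).det =
        (Matrix.of fun r i : Fin n => φ r (X ^ (i : ℕ))).det := by
    have factor : (Matrix.of fun r i => φ r (f i)) =
        (Matrix.of fun r i : Fin n => φ r (X ^ (i : ℕ))) *
          (Matrix.of fun i j : Fin n => (f j).coeff i) := by
      ext r i
      simp only [Matrix.mul_apply, Matrix.of_apply]
      conv_lhs => rw [(f i).as_sum_range' n (by rw [hf]; exact i.2)]
      rw [map_sum, Finset.sum_range]
      refine Finset.sum_congr rfl fun j _ => ?_
      rw [← C_mul_X_pow_eq_monomial, ← smul_eq_C_mul, map_smul, smul_eq_mul, mul_comm]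
    rw [factor, Matrix.det_mul, Matrix.det_matrixOfPolynomials f hf hf', mul_one]
  rw [eq_monomials hp hp', eq_monomials hq hq']

/-- The vector of the `l`-th Taylor coefficients at `x` of a family of polynomials. -/
def jet {ι : Type*} (p : ι → R[X]) (x : R) (l : ℕ) : ι → R :=
  fun i => (taylor x (p i)).coeff l

/-- The confluent Vandermonde matrix of a family of polynomials: the row `m * L + l` lists their
`l`-th Taylor coefficients at `x m`. -/
def confluentVandermonde {ι : Type*} {N : ℕ} (L : ℕ) (x : Fin N → R) (p : ι → R[X]) :
    Matrix (Fin (N * L)) ι R :=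
  Matrix.of fun r => jet p (x r.divNat) r.modNat

/-- The Newton basis `1, X - x₀, …, (X - x₀)^L, (X - x₀)^L (X - x₁), …` for Hermite interpolation
to order `L` at the points `x m`. -/
def hermiteNewton {N : ℕ} (L : ℕ) (x : Fin N → R) (s : Fin (N * L)) : R[X] :=
  (X - C (x s.divNat)) ^ (s.modNat : ℕ) * ∏ m ∈ Finset.Iio s.divNat, (X - C (x m)) ^ L

theorem taylor_X_sub_C_pow_mul (y : R) (k : ℕ) (g : R[X]) :
    taylor y ((X - C y) ^ k * g) = X ^ k * taylor y g := by
  rw [taylor_mul, taylor_pow, map_sub, taylor_X, taylor_C, add_sub_cancel_right]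

theorem coeff_taylor_eq_zero_of_dvd {y : R} {k l : ℕ} {f : R[X]} (hf : (X - C y) ^ k ∣ f)
    (hl : l < k) : (taylor y f).coeff l = 0 := by
  obtain ⟨g, rfl⟩ := hf
  rw [taylor_X_sub_C_pow_mul, coeff_X_pow_mul', if_neg hl.not_ge]

variable {N L : ℕ}

theorem monic_hermiteNewton (x : Fin N → R) (s : Fin (N * L)) : (hermiteNewton L x s).Monic :=
  ((monic_X_sub_C _).pow _).mul (monic_prod_of_monic _ _ fun _ _ => (monic_X_sub_C _).pow _)

theorem natDegree_hermiteNewton [Nontrivial R] (x : Fin N → R) (s : Fin (N * L)) :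
    (hermiteNewton L x s).natDegree = s := by
  have natDegree_power (y : R) (k : ℕ) : ((X - C y) ^ k).natDegree = k := by
    rw [(monic_X_sub_C y).natDegree_pow, natDegree_X_sub_C, mul_one]
  rw [hermiteNewton, ((monic_X_sub_C _).pow _).natDegree_mul
      (monic_prod_of_monic _ _ fun _ _ => (monic_X_sub_C _).pow _),
    natDegree_prod_of_monic _ _ fun _ _ => (monic_X_sub_C _).pow _]
  simp only [natDegree_power, Finset.sum_const, Fin.card_Iio, smul_eq_mul, Fin.coe_divNat,
    Fin.coe_modNat]
  exact Nat.mod_add_div' _ _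

theorem jet_hermiteNewton_of_lt (x : Fin N → R) {r s : Fin (N * L)} (hrs : r < s) :
    jet (hermiteNewton L x) (x r.divNat) r.modNat s = 0 := by
  have div_le : r.divNat ≤ s.divNat := Nat.div_le_div_right hrs.le
  rcases div_le.lt_or_eq with hlt | heq
  · refine coeff_taylor_eq_zero_of_dvd (dvd_mul_of_dvd_right ?_ _) r.modNat.2
    exact Finset.dvd_prod_of_mem (fun m => (X - C (x m)) ^ L) (Finset.mem_Iio.2 hlt)
  · have mod_lt : (r.modNat : ℕ) < s.modNat := by
      have hdiv : (r : ℕ) / L = s / L := congrArg Fin.val heq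
      have hr := Nat.div_add_mod (r : ℕ) L
      have hs := Nat.div_add_mod (s : ℕ) L
      rw [hdiv] at hr
      simp only [Fin.coe_modNat]
      omega
    rw [heq]
    exact coeff_taylor_eq_zero_of_dvd (dvd_mul_right _ _) mod_lt

theorem jet_hermiteNewton_self (x : Fin N → R) (s : Fin (N * L)) :
    jet (hermiteNewton L x) (x s.divNat) s.modNat s =
      ∏ m ∈ Finset.Iio s.divNat, (x s.divNat - x m) ^ L := by
  rw [jet, hermiteNewton, taylor_X_sub_C_pow_mul, coeff_X_pow_mul', if_pos le_rfl, Nat.sub_self,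
    taylor_coeff_zero, eval_prod]
  simp only [eval_pow, eval_sub, eval_X, eval_C]

theorem divNat_finProdFinEquiv (i : Fin N × Fin L) : (finProdFinEquiv i).divNat = i.1 :=
  congrArg Prod.fst (finProdFinEquiv.symm_apply_apply i)

theorem modNat_finProdFinEquiv (i : Fin N × Fin L) : (finProdFinEquiv i).modNat = i.2 :=
  congrArg Prod.snd (finProdFinEquiv.symm_apply_apply i)

theorem det_confluentVandermonde_hermiteNewton (x : Fin N → R) :
    (confluentVandermonde L x (hermiteNewton L x)).det =
      (Matrix.vandermonde x).det ^ L ^ 2 := by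
  have lower : (confluentVandermonde L x (hermiteNewton L x)).IsLowerTriangular :=
    fun _ _ hrs => jet_hermiteNewton_of_lt x hrs
  have diagonal (s : Fin (N * L)) : confluentVandermonde L x (hermiteNewton L x) s s =
      ∏ m ∈ Finset.Iio s.divNat, (x s.divNat - x m) ^ L := jet_hermiteNewton_self x s
  rw [Matrix.det_of_isLowerTriangular _ lower, ← finProdFinEquiv.prod_comp,
    Fintype.prod_prod_type]
  simp only [diagonal, divNat_finProdFinEquiv, Finset.prod_const, Finset.card_univ,
    Fintype.card_fin, Finset.prod_pow, ← pow_mul, ← sq]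
  rw [Matrix.det_vandermonde, Finset.prod_comm' (t' := Finset.univ) (s' := Finset.Ioi) (by simp)]

theorem det_confluentVandermonde (x : Fin N → R) {p : Fin (N * L) → R[X]}
    (hdeg : ∀ i, (p i).natDegree = i) (hmonic : ∀ i, (p i).Monic) :
    (confluentVandermonde L x p).det = (Matrix.vandermonde x).det ^ L ^ 2 := by
  nontriviality R
  rw [← det_confluentVandermonde_hermiteNewton]
  exact det_functional_eq_of_monic (fun r => lcoeff R r.modNat ∘ₗ taylor (x r.divNat)) hdeg
    hmonic (natDegree_hermiteNewton x) (monic_hermiteNewton x)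

end ConfluentVandermonde

section DecomposableForms

variable {n L : ℕ}

theorem wronskian_eq_det_jet (p : Fin n → Polynomial ℝ) (t : Fin L → Fin n) (x : ℝ) :
    wronskian p t x = Matrix.det (Matrix.of fun i l : Fin L => jet p x l (t i)) := by
  unfold wronskian
  congr 1
  ext i l
  simp only [Matrix.of_apply, jet]
  rw [Polynomial.taylor_coeff, ← Polynomial.factorial_smul_hasseDeriv, LinearMap.smul_apply,
    nsmul_eq_mul, Polynomial.eval_natCast_mul, inv_mul_cancel_left₀]
  exact_mod_cast Nat.factorial_ne_zero _

theorem omega_eq_ιMulti (p : Fin n → Polynomial ℝ) (x : ℝ) :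
    omega L p x = exteriorPower.ιMulti ℝ L fun l : Fin L => jet p x l := by
  rw [← (formBasis n L).sum_repr (exteriorPower.ιMulti ℝ L fun l : Fin L => jet p x l),
    ← Set.powersetCard.ofFinEmbEquiv.sum_comp]
  refine Finset.sum_congr rfl fun t _ => ?_
  congr 1
  · rw [formBasis, exteriorPower.basis_repr_apply, exteriorPower.ιMultiDual_apply_ιMulti,
      wronskian_eq_det_jet, ← Matrix.det_transpose]
    congr 1
    ext i l
    simp
  · rw [formBasis, basicForm, exteriorPower.basis_apply, exteriorPower.ιMulti_family]
    congr 1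
    ext i j
    simp [e]

theorem coe_omega (p : Fin n → Polynomial ℝ) (x : ℝ) :
    (omega L p x : ExteriorAlgebra ℝ (Fin n → ℝ)) =
      ExteriorAlgebra.ιMulti ℝ L fun l : Fin L => jet p x l := by
  rw [omega_eq_ιMulti, exteriorPower.ιMulti_apply_coe]

theorem volCoeff_ιMulti (v : Fin n → Fin n → ℝ) :
    volCoeff n (ExteriorAlgebra.ιMulti ℝ n v) = Matrix.det (Matrix.of v) := by
  rw [volCoeff, ExteriorAlgebra.liftAlternating_apply_ιMulti, Pi.single_eq_same]
  rfl

theorem prod_ιMulti {R M : Type*} [CommRing R] [AddCommGroup M] [Module R M] {N : ℕ}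
    (v : Fin N → Fin L → M) :
    (List.ofFn fun m => ExteriorAlgebra.ιMulti R L (v m)).prod =
      ExteriorAlgebra.ιMulti R (N * L) fun r => v r.divNat r.modNat := by
  simp only [ExteriorAlgebra.ιMulti_apply]
  rw [List.ofFn_mul, List.prod_flatten, List.map_ofFn]
  congr 2
  ext m
  simp only [Function.comp]
  congr 2
  ext l
  have index_eq : (⟨m * L + l, by
      calc m * L + l < (m + 1) * L := by rw [Nat.add_mul, one_mul]; omega
        _ ≤ N * L := Nat.mul_le_mul_right _ m.2⟩ : Fin (N * L)) = finProdFinEquiv (m, l) := by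
    ext
    simp only [finProdFinEquiv_apply_val]
    ring
  rw [index_eq, divNat_finProdFinEquiv, modNat_finProdFinEquiv]

theorem volCoeff_prod_omega {N : ℕ} {p : Fin (N * L) → Polynomial ℝ} (hp : IsCompleteMonic p)
    (x : Fin N → ℝ) :
    volCoeff (N * L) (List.ofFn fun m =>
      (omega L p (x m) : ExteriorAlgebra ℝ (Fin (N * L) → ℝ))).prod =
      (Matrix.vandermonde x).det ^ L ^ 2 := by
  simp only [coe_omega]
  rw [prod_ιMulti, volCoeff_ιMulti,
    ← det_confluentVandermonde x (fun i => (hp i).2) fun i => (hp i).1]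
  rfl

end DecomposableForms

section ExteriorAlgebra

open ExteriorAlgebra

variable {R V : Type*} [CommRing R] [AddCommGroup V] [Module R V]

theorem ι_mul_ι_eq_neg (u v : V) : ι R u * ι R v = -(ι R v * ι R u) :=
  eq_neg_of_add_eq_zero_left (ι_add_mul_swap u v)

theorem ι_mul_ιMulti (w : V) {n : ℕ} (v : Fin n → V) :
    ι R w * ιMulti R n v = (-1 : R) ^ n • (ιMulti R n v * ι R w) := by
  induction n with
  | zero => simp
  | succ n ih =>
    rw [ιMulti_succ_apply, ← mul_assoc, ι_mul_ι_eq_neg, neg_mul, mul_assoc, ih, mul_smul_comm,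
      pow_succ, mul_neg_one, neg_smul, mul_assoc]

theorem commute_of_mem_even {n : ℕ} (hn : Even n) {a : ExteriorAlgebra R V} (ha : a ∈ ⋀[R]^n V)
    (b : ExteriorAlgebra R V) : Commute a b := by
  rw [← ιMulti_span_fixedDegree] at ha
  induction b using ExteriorAlgebra.induction with
  | algebraMap r => exact (Algebra.commutes r a).symm
  | ι w =>
    induction ha using Submodule.span_induction with
    | mem a ha =>
      obtain ⟨v, rfl⟩ := ha
      have h := ι_mul_ιMulti (R := R) w v
      rw [hn.neg_one_pow, one_smul] at h
      exact h.symm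
    | zero => exact Commute.zero_left _
    | add a b _ _ ha hb => exact ha.add_left hb
    | smul c a _ ha => exact ha.smul_left c
  | mul b c hb hc => exact hb.mul_right hc
  | add b c hb hc => exact hb.add_right hc

theorem ι_mul_ι_mem (u v : V) : ι R u * ι R v ∈ ⋀[R]^2 V := by
  rw [exteriorPower, sq]
  exact Submodule.mul_mem_mul ⟨u, rfl⟩ ⟨v, rfl⟩

theorem commute_ι_mul_ι (u v : V) (b : ExteriorAlgebra R V) : Commute (ι R u * ι R v) b :=
  commute_of_mem_even even_two (ι_mul_ι_mem u v) b

theorem ι_mul_ι_mul_self (u v : V) : (ι R u * ι R v) * (ι R u * ι R v) = 0 := by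
  rw [← mul_assoc, (commute_ι_mul_ι u v (ι R u)).eq, ← mul_assoc, ι_sq_zero, zero_mul, zero_mul]

theorem ι_mul_ιMulti_eq_zero {n : ℕ} (v : Fin n → V) (i : Fin n) :
    ι R (v i) * ιMulti R n v = 0 := by
  have h := ιMulti_succ_apply (R := R) (n := n) (Fin.cons (v i) v)
  rw [Fin.cons_zero] at h
  refine h.symm.trans (AlternatingMap.map_eq_zero_of_eq _ _ (i := 0) (j := i.succ) ?_ ?_)
  · simp
  · exact (Fin.succ_ne_zero i).symm

theorem add_pow_succ_of_mul_self_eq_zero {A : Type*} [Ring A] {a b : A} (h : Commute a b)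
    (hb : b * b = 0) (m : ℕ) : (a + b) ^ (m + 1) = a ^ (m + 1) + (m + 1) • (a ^ m * b) := by
  induction m with
  | zero => simp
  | succ m ih =>
    have shift : a ^ m * b * a = a ^ (m + 1) * b := by rw [mul_assoc, ← h.eq, ← mul_assoc, pow_succ]
    have vanish : a ^ m * b * b = 0 := by rw [mul_assoc, hb, mul_zero]
    rw [pow_succ, ih, add_mul, mul_add, smul_mul_assoc, mul_add, shift, vanish, add_zero,
      ← pow_succ, add_assoc, ← succ_nsmul']

theorem mul_add_pow_of_mul_eq_zero {A : Type*} [Ring A] {s a b : A} (h : Commute a b)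
    (hs : s * b = 0) (m : ℕ) : s * (a + b) ^ m = s * a ^ m := by
  induction m with
  | zero => simp
  | succ m ih =>
    rw [pow_succ, ← mul_assoc, ih, mul_assoc, mul_add, mul_add, (h.pow_left m).eq, ← mul_assoc s b,
      hs, zero_mul, add_zero, pow_succ]

theorem ιMulti_succ_apply_last {n : ℕ} (v : Fin (n + 1) → V) :
    ιMulti R (n + 1) v = ιMulti R n (Fin.init v) * ι R (v (Fin.last n)) := by
  simp only [ιMulti_apply]
  rw [List.ofFn_succ', List.concat_eq_append, List.prod_append, List.prod_singleton]
  rfl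

theorem sum_nested_pow (v : ℕ → V) (M : ℕ) :
    (∑ a ∈ Finset.range M, ι R (v a) * ι R (v (2 * M - 1 - a))) ^ M =
      M.factorial • ιMulti R (2 * M) fun i => v i := by
  induction M generalizing v with
  | zero => simp
  | succ M ih =>
    set w : ℕ → V := fun i => v (i + 1) with hw
    set inner := ∑ a ∈ Finset.range M, ι R (w a) * ι R (w (2 * M - 1 - a)) with h_inner
    have peel : ∑ a ∈ Finset.range (M + 1), ι R (v a) * ι R (v (2 * (M + 1) - 1 - a)) =
        inner + ι R (v 0) * ι R (v (2 * M + 1)) := by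
      rw [Finset.sum_range_succ']
      congr 1
      refine Finset.sum_congr rfl fun a ha => ?_
      rw [Finset.mem_range] at ha
      rw [hw, show 2 * (M + 1) - 1 - (a + 1) = 2 * M - 1 - a + 1 by omega]
    have inner_pow_succ : inner ^ (M + 1) = 0 := by
      rw [pow_succ', h_inner, ih w, Finset.sum_mul]
      refine Finset.sum_eq_zero fun a ha => ?_
      rw [Finset.mem_range] at ha
      rw [mul_smul_comm, mul_assoc,
        ι_mul_ιMulti_eq_zero (fun i : Fin (2 * M) => w i) ⟨2 * M - 1 - a, by omega⟩, mul_zero,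
        smul_zero]
    have commutes : Commute (ιMulti R (2 * M) fun i => w i) (ι R (v 0)) :=
      commute_of_mem_even (even_two_mul M) (exteriorPower.ιMulti R (2 * M) _).2 _
    have wedge_eq : ιMulti R (2 * M + 2) (fun i => v i) =
        ιMulti R (2 * M) (fun i => w i) * (ι R (v 0) * ι R (v (2 * M + 1))) := by
      rw [← mul_assoc, commutes.eq, ιMulti_succ_apply,
        ιMulti_succ_apply_last, mul_assoc]
      rfl
    rw [peel, add_pow_succ_of_mul_self_eq_zero (commute_ι_mul_ι _ _ _).symm
      (ι_mul_ι_mul_self _ _), inner_pow_succ, zero_add, ih w, Nat.factorial_succ, mul_nsmul',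
      smul_mul_assoc, ← wedge_eq]
    rfl

end ExteriorAlgebra

section Antisymmetrization

variable {R X Y A ι : Type*} [CommRing R]

/-- The signed sum of `w` over the rearrangements of its arguments, not divided by `n!`. -/
def antisymmetrization {n : ℕ} (w : (Fin n → X) → R) (x : Fin n → X) : R :=
  ∑ σ : Equiv.Perm (Fin n), Equiv.Perm.sign σ • w (x ∘ σ)

theorem antisymmetrization_comp_perm {n : ℕ} (w : (Fin n → X) → R) (x : Fin n → X)
    (σ : Equiv.Perm (Fin n)) :
    antisymmetrization w (x ∘ σ) = Equiv.Perm.sign σ • antisymmetrization w x := by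
  unfold antisymmetrization
  rw [← Equiv.sum_comp (Equiv.mulLeft σ) fun τ => Equiv.Perm.sign τ • w (x ∘ τ),
    Finset.smul_sum]
  refine Finset.sum_congr rfl fun τ _ => ?_
  rw [Equiv.coe_mulLeft, Equiv.Perm.sign_mul, smul_smul, ← mul_assoc, Int.units_mul_self, one_mul]
  rfl

theorem sum_smul_alternating_comp {n : ℕ} {V W : Type*} [AddCommGroup V] [Module R V]
    [AddCommGroup W] [Module R W] (g : V [⋀^Fin n]→ₗ[R] W) (v : Fin n → V)
    (w : (Fin n → X) → R) (x : Fin n → X) :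
    ∑ f : Fin n → Fin n, w (x ∘ f) • g (v ∘ f) = antisymmetrization w x • g v := by
  classical
  rw [antisymmetrization, Finset.sum_smul,
    ← Finset.sum_subset (Finset.subset_univ
      (Finset.univ.image fun σ : Equiv.Perm (Fin n) => (σ : Fin n → Fin n))),
    Finset.sum_image fun _ _ _ _ h => Equiv.coe_fn_injective h]
  · refine Finset.sum_congr rfl fun σ _ => ?_
    rw [g.map_perm, smul_comm, smul_assoc]
  · intro f _ hf
    rw [g.map_eq_zero_of_not_injective, smul_zero]
    refine fun hinj => hf (Finset.mem_image.2 ?_)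
    exact ⟨Equiv.ofBijective f (Finite.injective_iff_bijective.1 hinj.of_comp),
      Finset.mem_univ _, rfl⟩

/-- The product `k(x₀, x₁) k(x₂, x₃) ⋯ k(x_{2M-2}, x_{2M-1})` over consecutive pairs. -/
def pairWeight (k : Y → Y → R) : (M : ℕ) → (Fin (2 * M) → Y) → R
  | 0, _ => 1
  | M + 1, x => k (x (0 : Fin (2 * M + 2))) (x (1 : Fin (2 * M + 2))) *
      pairWeight k M (Fin.tail (n := 2 * M) (Fin.tail (n := 2 * M + 1) x))

theorem pairWeight_comp (k : Y → Y → R) (x : X → Y) (M : ℕ) (f : Fin (2 * M) → X) :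
    pairWeight k M (x ∘ f) = pairWeight (fun i j => k (x i) (x j)) M f := by
  induction M with
  | zero => rfl
  | succ M ih => exact congrArg _ (ih _)

variable [Ring A] [Algebra R A] [Fintype ι]

theorem sum_fin_succ_fun {B : Type*} [AddCommMonoid B] {n : ℕ} (w : (Fin (n + 1) → ι) → B) :
    ∑ f, w f = ∑ i, ∑ f : Fin n → ι, w (Fin.cons i f) := by
  rw [← (Fin.consEquiv fun _ : Fin (n + 1) => ι).sum_comp, Fintype.sum_prod_type]
  rfl

theorem sum_pair_pow (k : ι → ι → R) (g : ι → A) (M : ℕ) :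
    (∑ i, ∑ j, k i j • (g i * g j)) ^ M =
      ∑ f : Fin (2 * M) → ι, pairWeight k M f • (List.ofFn fun i => g (f i)).prod := by
  induction M with
  | zero =>
    rw [pow_zero, Fintype.sum_eq_single (fun i => i.elim0)
      fun f hf => absurd (funext fun i => i.elim0) hf]
    simp [pairWeight]
  | succ M ih =>
    have split := sum_fin_succ_fun (n := 2 * M + 1)
      fun f : Fin (2 * M + 1 + 1) → ι => pairWeight k (M + 1) f • (List.ofFn fun i => g (f i)).prod
    rw [pow_succ', ih]
    refine Eq.trans ?_ split.symm
    simp only [sum_fin_succ_fun, Finset.sum_mul]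
    refine Finset.sum_congr rfl fun i _ => Finset.sum_congr rfl fun j _ => ?_
    rw [Finset.mul_sum]
    refine Finset.sum_congr rfl fun f _ => ?_
    rw [List.ofFn_succ, List.ofFn_succ, List.prod_cons, List.prod_cons, smul_mul_smul_comm,
      mul_assoc]
    rfl

theorem sum_mul_sum_pair_pow (k : ι → ι → R) (g : ι → A) (M : ℕ) :
    (∑ i, g i) * (∑ i, ∑ j, k i j • (g i * g j)) ^ M =
      ∑ f : Fin (2 * M + 1) → ι,
        pairWeight k M (Fin.tail f) • (List.ofFn fun i => g (f i)).prod := by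
  rw [sum_pair_pow, sum_fin_succ_fun, Finset.sum_mul_sum]
  refine Finset.sum_congr rfl fun i _ => Finset.sum_congr rfl fun f _ => ?_
  rw [List.ofFn_succ, List.prod_cons, mul_smul_comm]
  rfl

end Antisymmetrization

section PairSums

open ExteriorAlgebra

variable {R V X : Type*} [CommRing R] [AddCommGroup V] [Module R V]

theorem pow_sum_pair_ι (k : X → X → R) {M : ℕ} (x : Fin (2 * M) → X) (v : Fin (2 * M) → V) :
    (∑ i, ∑ j, k (x i) (x j) • (ι R (v i) * ι R (v j))) ^ M =
      antisymmetrization (pairWeight k M) x • ιMulti R (2 * M) v := by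
  rw [sum_pair_pow (fun i j => k (x i) (x j)) (fun i => ι R (v i)), ← sum_smul_alternating_comp]
  simp only [pairWeight_comp, ιMulti_apply, Function.comp_apply]

theorem sum_ι_mul_pow_sum_pair_ι (k : X → X → R) {M : ℕ} (x : Fin (2 * M + 1) → X)
    (v : Fin (2 * M + 1) → V) :
    (∑ i, ι R (v i)) * (∑ i, ∑ j, k (x i) (x j) • (ι R (v i) * ι R (v j))) ^ M =
      antisymmetrization (fun y => pairWeight k M (Fin.tail y)) x • ιMulti R (2 * M + 1) v := by
  rw [sum_mul_sum_pair_pow (fun i j => k (x i) (x j)) (fun i => ι R (v i)),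
    ← sum_smul_alternating_comp]
  refine Finset.sum_congr rfl fun f _ => ?_
  rw [ιMulti_apply]
  exact congrArg (· • _) (pairWeight_comp k x M (Fin.tail f)).symm

theorem sum_sum_eq_two_nsmul_sum_Ioi {ι B : Type*} [Fintype ι] [LinearOrder ι]
    [LocallyFiniteOrderTop ι] [LocallyFiniteOrderBot ι] [AddCommMonoid B] {f : ι → ι → B}
    (symm : ∀ i j, f j i = f i j) (diag : ∀ i, f i i = 0) :
    ∑ i, ∑ j, f i j = 2 • ∑ i, ∑ j ∈ Finset.Ioi i, f i j := by
  have off_diag := Finset.sum_sum_Ioi_add_eq_sum_sum_off_diag f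
  simp only [symm, ← two_nsmul, Finset.sum_nsmul] at off_diag
  rw [off_diag]
  refine Finset.sum_congr rfl fun i _ => ?_
  rw [Fintype.sum_eq_add_sum_compl i, diag, zero_add]

/-- The `2`-form `∑_{i < j} v_i ∧ v_j`. -/
def pairSum (R : Type*) [CommRing R] [Module R V] {n : ℕ} (v : Fin n → V) : ExteriorAlgebra R V :=
  ∑ i, ∑ j ∈ Finset.Ioi i, ι R (v i) * ι R (v j)

theorem pairSum_eq_sum_ite {n : ℕ} (v : Fin n → V) :
    pairSum R v = ∑ i, ∑ j, (if i < j then 1 else 0 : R) • (ι R (v i) * ι R (v j)) := by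
  simp only [pairSum, ite_smul, one_smul, zero_smul, ← Finset.sum_filter,
    Finset.filter_lt_eq_Ioi]

theorem pairSum_pow_eq_zero {n m : ℕ} (h : n < 2 * m) (v : Fin n → V) : pairSum R v ^ m = 0 := by
  rw [pairSum_eq_sum_ite, sum_pair_pow _ fun i => ι R (v i)]
  refine Finset.sum_eq_zero fun f _ => ?_
  have not_injective : ¬ Function.Injective (v ∘ f) := fun hf =>
    absurd (Fintype.card_le_of_injective f hf.of_comp) (by simpa using h)
  have vanish := (ιMulti R (2 * m)).map_eq_zero_of_not_injective _ not_injective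
  rw [ιMulti_apply] at vanish
  exact (congrArg _ vanish).trans (smul_zero _)

theorem pairSum_succ {n : ℕ} (v : Fin (n + 1) → V) :
    pairSum R v = pairSum R (Fin.tail v) + ι R (v 0) * ∑ i, ι R (Fin.tail v i) := by
  rw [pairSum, Fin.sum_univ_succ, Fin.sum_Ioi_zero, add_comm, Finset.mul_sum]
  simp only [Fin.sum_Ioi_succ]
  rfl

theorem pairSum_succ_pow_succ {n : ℕ} (v : Fin (n + 1) → V) (m : ℕ) :
    pairSum R v ^ (m + 1) = pairSum R (Fin.tail v) ^ (m + 1) +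
      (m + 1) • (ι R (v 0) * ((∑ i, ι R (Fin.tail v i)) * pairSum R (Fin.tail v) ^ m)) := by
  rw [pairSum_succ, ← map_sum, add_pow_succ_of_mul_self_eq_zero (commute_ι_mul_ι _ _ _).symm
    (ι_mul_ι_mul_self _ _), ← (commute_ι_mul_ι _ _ _).eq, mul_assoc]

theorem sum_ι_mul_pairSum_pow {n : ℕ} (v : Fin (n + 1) → V) (m : ℕ) :
    (∑ i, ι R (v i)) * pairSum R v ^ m = (∑ i, ι R (v i)) * pairSum R (Fin.tail v) ^ m := by
  have annihilate : (∑ i, ι R (v i)) * (ι R (v 0) * ∑ i, ι R (Fin.tail v i)) = 0 := by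
    have split : ∑ i, ι R (Fin.tail v i) = ∑ i, ι R (v i) - ι R (v 0) := by
      rw [Fin.sum_univ_succ, add_sub_cancel_left]
      rfl
    rw [split, mul_sub, ι_sq_zero, sub_zero, ← mul_assoc, ← map_sum, mul_assoc,
      ι_mul_ι_eq_neg (v 0), mul_neg, ← mul_assoc, ι_sq_zero, zero_mul, neg_zero]
  rw [pairSum_succ]
  refine mul_add_pow_of_mul_eq_zero ?_ annihilate m
  rw [← map_sum]
  exact (commute_ι_mul_ι _ _ _).symm

theorem pairSum_pow (M : ℕ) :
    (∀ v : Fin (2 * M) → V, pairSum R v ^ M = M.factorial • ιMulti R (2 * M) v) ∧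
      ∀ v : Fin (2 * M + 1) → V, (∑ i, ι R (v i)) * pairSum R v ^ M =
        M.factorial • ιMulti R (2 * M + 1) v := by
  have odd_of_even (M : ℕ)
      (even : ∀ v : Fin (2 * M) → V, pairSum R v ^ M = M.factorial • ιMulti R (2 * M) v)
      (v : Fin (2 * M + 1) → V) :
      (∑ i, ι R (v i)) * pairSum R v ^ M = M.factorial • ιMulti R (2 * M + 1) v := by
    have tail_vanish : (∑ i, ι R (Fin.tail v i)) * ιMulti R (2 * M) (Fin.tail v) = 0 := by
      rw [Finset.sum_mul]
      exact Finset.sum_eq_zero fun i _ => ι_mul_ιMulti_eq_zero (Fin.tail v) i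
    rw [sum_ι_mul_pairSum_pow, even, mul_smul_comm, Fin.sum_univ_succ, add_mul]
    refine congrArg _ ((congrArg _ tail_vanish).trans ?_)
    rw [add_zero, ιMulti_succ_apply]
    rfl
  induction M with
  | zero => exact ⟨fun v => by simp, odd_of_even 0 fun v => by simp⟩
  | succ M ih =>
    have even (v : Fin (2 * M + 1 + 1) → V) :
        pairSum R v ^ (M + 1) = (M + 1).factorial • ιMulti R (2 * M + 1 + 1) v := by
      rw [pairSum_succ_pow_succ, pairSum_pow_eq_zero (by omega), zero_add, ih.2, mul_smul_comm,
        smul_smul, ← Nat.factorial_succ]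
      exact congrArg _ (ιMulti_succ_apply v).symm
    exact ⟨even, odd_of_even (M + 1) even⟩

end PairSums

section VandermondeAntisymmetrization

open ExteriorAlgebra

theorem det_vandermonde_comp_perm {R : Type*} [CommRing R] {n : ℕ} (x : Fin n → R)
    (σ : Equiv.Perm (Fin n)) :
    (Matrix.vandermonde (x ∘ σ)).det = Equiv.Perm.sign σ • (Matrix.vandermonde x).det := by
  rw [Units.smul_def, zsmul_eq_mul, ← Matrix.det_permute σ (Matrix.vandermonde x)]
  rfl

theorem det_vandermonde_pos {n : ℕ} {x : Fin n → ℝ} (hx : StrictMono x) :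
    0 < (Matrix.vandermonde x).det := by
  rw [Matrix.det_vandermonde]
  exact Finset.prod_pos fun i _ => Finset.prod_pos fun j hj =>
    sub_pos.2 (hx (Finset.mem_Ioi.1 hj))

theorem antisymmetrization_eq_mul_sign_det_vandermonde {n : ℕ} {w : (Fin n → ℝ) → ℝ} {c : ℝ}
    (h : ∀ x, StrictMono x → antisymmetrization w x = c) {x : Fin n → ℝ}
    (hx : Function.Injective x) :
    antisymmetrization w x = c * Real.sign (Matrix.vandermonde x).det := by
  have sorted : StrictMono (x ∘ Tuple.sort x) :=
    (Tuple.monotone_sort x).strictMono_of_injective (hx.comp (Tuple.sort x).injective)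
  have value := h _ sorted
  have sign_eq := Real.sign_of_pos (det_vandermonde_pos sorted)
  rw [antisymmetrization_comp_perm] at value
  rw [det_vandermonde_comp_perm] at sign_eq
  rcases Int.units_eq_one_or (Equiv.Perm.sign (Tuple.sort x)) with hσ | hσ
  · rw [hσ, one_smul] at value sign_eq
    rw [value, sign_eq, mul_one]
  · rw [hσ, Units.neg_smul, one_smul] at value sign_eq
    rw [Real.sign_neg] at sign_eq
    linear_combination -value + c * sign_eq

theorem smul_volForm_inj {n : ℕ} {a b : ℝ} : a • volForm n = b • volForm n ↔ a = b := by
  refine ⟨fun h => ?_, fun h => h ▸ rfl⟩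
  simpa only [map_smul, volCoeff_volForm, smul_eq_mul, mul_one] using congrArg (volCoeff n) h

theorem sum_sum_sign_sub_smul {V : Type*} [AddCommGroup V] [Module ℝ V] {n : ℕ} {x : Fin n → ℝ}
    (hx : StrictMono x) (v : Fin n → V) :
    ∑ i, ∑ j, Real.sign (x j - x i) • (ι ℝ (v i) * ι ℝ (v j)) = 2 • pairSum ℝ v := by
  rw [sum_sum_eq_two_nsmul_sum_Ioi]
  · refine congrArg _ (Finset.sum_congr rfl fun i _ => Finset.sum_congr rfl fun j hj => ?_)
    rw [Real.sign_of_pos (sub_pos.2 (hx (Finset.mem_Ioi.1 hj))), one_smul]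
  · intro i j
    rw [← neg_sub, Real.sign_neg, ι_mul_ι_eq_neg, neg_smul_neg]
  · intro i
    rw [ι_sq_zero, smul_zero]

theorem antisymmetrization_pairWeight_sign (M : ℕ) {x : Fin (2 * M) → ℝ}
    (hx : Function.Injective x) :
    antisymmetrization (pairWeight (fun s t => Real.sign (t - s)) M) x =
      2 ^ M * M.factorial * Real.sign (Matrix.vandermonde x).det := by
  refine antisymmetrization_eq_mul_sign_det_vandermonde (fun x hx => ?_) hx
  have h := pow_sum_pair_ι (fun s t => Real.sign (t - s)) x e
  rw [sum_sum_sign_sub_smul hx, smul_pow, (pairSum_pow M).1, smul_smul,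
    ← Nat.cast_smul_eq_nsmul ℝ, ← volForm, smul_volForm_inj] at h
  rw [← h]
  push_cast
  rfl

theorem antisymmetrization_pairWeight_sign_tail (M : ℕ) {x : Fin (2 * M + 1) → ℝ}
    (hx : Function.Injective x) :
    antisymmetrization (fun y => pairWeight (fun s t => Real.sign (t - s)) M (Fin.tail y)) x =
      2 ^ M * M.factorial * Real.sign (Matrix.vandermonde x).det := by
  refine antisymmetrization_eq_mul_sign_det_vandermonde (fun x hx => ?_) hx
  have h := sum_ι_mul_pow_sum_pair_ι (fun s t => Real.sign (t - s)) x e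
  rw [sum_sum_sign_sub_smul hx, smul_pow, mul_smul_comm, (pairSum_pow M).2, smul_smul,
    ← Nat.cast_smul_eq_nsmul ℝ, ← volForm, smul_volForm_inj] at h
  rw [← h]
  push_cast
  rfl

theorem sq_pow_sub_pow_div_sub {K : Type*} [Field K] (M : ℕ) (x y : K) :
    (y ^ M - x ^ M) ^ 2 / (y - x) = ∑ a ∈ Finset.range M,
      (x ^ a * y ^ (2 * M - 1 - a) - x ^ (2 * M - 1 - a) * y ^ a) := by
  have factor : ∑ a ∈ Finset.range M,
      (x ^ a * y ^ (2 * M - 1 - a) - x ^ (2 * M - 1 - a) * y ^ a) =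
        (y ^ M - x ^ M) * ∑ a ∈ Finset.range M, x ^ a * y ^ (M - 1 - a) := by
    rw [sub_mul, Finset.mul_sum, Finset.mul_sum,
      ← Finset.sum_range_reflect fun a => x ^ M * (x ^ a * y ^ (M - 1 - a)),
      ← Finset.sum_sub_distrib]
    refine Finset.sum_congr rfl fun a ha => ?_
    rw [Finset.mem_range] at ha
    rw [show 2 * M - 1 - a = M + (M - 1 - a) by omega,
      show M - 1 - (M - 1 - a) = a by omega, pow_add, pow_add]
    ring
  rcases eq_or_ne x y with rfl | hxy
  · simp [factor]
  · rw [factor, div_eq_iff (sub_ne_zero.2 hxy.symm), sq, mul_assoc]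
    congr 1
    linear_combination (Commute.all x y).geom_sum₂_mul M

theorem sum_sum_sq_pow_sub_pow_smul {K V : Type*} [Field K] [AddCommGroup V] [Module K V] {n : ℕ}
    (M : ℕ) (x : Fin n → K) (v : Fin n → V) :
    ∑ i, ∑ j, ((x j ^ M - x i ^ M) ^ 2 / (x j - x i)) • (ι K (v i) * ι K (v j)) =
      2 • ∑ a ∈ Finset.range M,
        ι K (∑ i, x i ^ a • v i) * ι K (∑ i, x i ^ (2 * M - 1 - a) • v i) := by
  have expand (a b : ℕ) : ι K (∑ i, x i ^ a • v i) * ι K (∑ i, x i ^ b • v i) =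
      ∑ i, ∑ j, (x i ^ a * x j ^ b) • (ι K (v i) * ι K (v j)) := by
    simp only [map_sum, map_smul, Finset.sum_mul_sum, smul_mul_smul_comm]
  have antisymm (a b : ℕ) :
      2 • (ι K (∑ i, x i ^ a • v i) * ι K (∑ i, x i ^ b • v i)) =
        ∑ i, ∑ j, (x i ^ a * x j ^ b - x i ^ b * x j ^ a) • (ι K (v i) * ι K (v j)) := by
    simp only [sub_smul, Finset.sum_sub_distrib, ← expand]
    rw [ι_mul_ι_eq_neg (∑ i, x i ^ b • v i), sub_neg_eq_add, two_nsmul]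
  simp only [Finset.smul_sum, antisymm, sq_pow_sub_pow_div_sub, Finset.sum_smul]
  rw [Finset.sum_comm]
  refine (Finset.sum_congr rfl fun i _ => Finset.sum_comm).trans ?_
  rw [Finset.sum_comm]
  exact Finset.sum_congr rfl fun a _ => Finset.sum_comm

theorem antisymmetrization_pairWeight_sq_pow_sub_pow (M : ℕ) (x : Fin (2 * M) → ℝ) :
    antisymmetrization (pairWeight (fun s t => (t ^ M - s ^ M) ^ 2 / (t - s)) M) x =
      2 ^ M * M.factorial * (Matrix.vandermonde x).det := by
  have rows_eq : (Matrix.of fun a : Fin (2 * M) => ∑ i, x i ^ (a : ℕ) • (e i : Fin (2 * M) → ℝ)) =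
      (Matrix.vandermonde x).transpose := by
    ext a i
    simp [e, Finset.sum_apply, Matrix.vandermonde_apply, Pi.single_apply]
  have h := congrArg (volCoeff (2 * M))
    (pow_sum_pair_ι (fun s t => (t ^ M - s ^ M) ^ 2 / (t - s)) x e)
  rw [sum_sum_sq_pow_sub_pow_smul, smul_pow, sum_nested_pow fun a => ∑ i, x i ^ a • e i,
    smul_smul, map_nsmul, volCoeff_ιMulti, rows_eq, Matrix.det_transpose, map_smul, ← volForm,
    volCoeff_volForm, smul_eq_mul, mul_one] at h
  rw [← h, nsmul_eq_mul]
  push_cast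
  rfl

end VandermondeAntisymmetrization

section WeakIntegral

/-- `I` is the weak integral of `F`: every linear functional of `F` is integrable, with integral
its value at `I`. Unlike the Bochner integral, this requires no norm, and so applies to forms and to
elements of the exterior algebra alike. -/
def HasWeakIntegral {X V : Type*} [MeasurableSpace X] [AddCommGroup V] [Module ℝ V]
    (μ : Measure X) (F : X → V) (I : V) : Prop :=
  ∀ φ : V →ₗ[ℝ] ℝ, Integrable (fun x => φ (F x)) μ ∧ ∫ x, φ (F x) ∂μ = φ I

namespace HasWeakIntegral

variable {X Y V W ι A : Type*} [MeasurableSpace X] [MeasurableSpace Y]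
  [AddCommGroup V] [Module ℝ V] [AddCommGroup W] [Module ℝ W] {μ : Measure X} {ν : Measure Y}

theorem map {F : X → V} {I : V} (h : HasWeakIntegral μ F I) (f : V →ₗ[ℝ] W) :
    HasWeakIntegral μ (fun x => f (F x)) (f I) :=
  fun φ => h (φ ∘ₗ f)

theorem of_sum [Fintype ι] (f : ι → X → ℝ) (a : ι → V) (hf : ∀ i, Integrable (f i) μ) :
    HasWeakIntegral μ (fun x => ∑ i, f i x • a i) (∑ i, (∫ x, f i x ∂μ) • a i) := by
  intro φ
  simp only [map_sum, map_smul, smul_eq_mul]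
  refine ⟨integrable_finsetSum _ fun i _ => (hf i).mul_const _, ?_⟩
  rw [integral_finsetSum _ fun i _ => (hf i).mul_const _]
  exact Finset.sum_congr rfl fun i _ => integral_mul_const _ _

theorem comp_measurableEquiv {G : Y → V} {I : V} (h : HasWeakIntegral ν G I) (f : X ≃ᵐ Y)
    (hf : MeasurePreserving f μ ν) : HasWeakIntegral μ (fun x => G (f x)) I := fun φ =>
  ⟨(hf.integrable_comp_emb f.measurableEmbedding).2 (h φ).1,
    (hf.integral_comp f.measurableEmbedding fun y => φ (G y)).trans (h φ).2⟩

theorem pi_zero (ν : Measure Y) (a : V) :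
    HasWeakIntegral (Measure.pi fun _ : Fin 0 => ν) (fun _ => a) a := by
  intro φ
  rw [Measure.pi_of_empty]
  exact ⟨integrable_const _, by simp⟩

theorem pi_succ [SigmaFinite ν] {n : ℕ} {G : Y × (Fin n → Y) → V} {I : V}
    (h : HasWeakIntegral (ν.prod (Measure.pi fun _ : Fin n => ν)) G I) :
    HasWeakIntegral (Measure.pi fun _ : Fin (n + 1) => ν) (fun x => G (x 0, Fin.tail x)) I :=
  h.comp_measurableEquiv _ (measurePreserving_piFinSuccAbove (fun _ : Fin (n + 1) => ν) 0)

theorem pi_add_two [SigmaFinite ν] {n : ℕ} {G : (Y × Y) × (Fin n → Y) → V} {I : V}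
    (h : HasWeakIntegral ((ν.prod ν).prod (Measure.pi fun _ : Fin n => ν)) G I) :
    HasWeakIntegral (Measure.pi fun _ : Fin (n + 2) => ν)
      (fun x => G ((x 0, x 1), Fin.tail (Fin.tail x))) I := by
  have split_second := (MeasurePreserving.id ν).prod
    (measurePreserving_piFinSuccAbove (fun _ : Fin (n + 1) => ν) 0)
  have reassociate := (measurePreserving_prodAssoc ν ν (Measure.pi fun _ : Fin n => ν)).symm
  exact ((h.comp_measurableEquiv MeasurableEquiv.prodAssoc.symm reassociate).comp_measurableEquiv
    ((MeasurableEquiv.refl Y).prodCongr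
      (MeasurableEquiv.piFinSuccAbove (fun _ : Fin (n + 1) => Y) 0)) split_second).pi_succ

variable [Ring A] [Algebra ℝ A] [Module.Finite ℝ A]

theorem mul [SFinite μ] [SFinite ν] {F : X → A} {G : Y → A} {I J : A}
    (hF : HasWeakIntegral μ F I) (hG : HasWeakIntegral ν G J) :
    HasWeakIntegral (μ.prod ν) (fun z => F z.1 * G z.2) (I * J) := by
  let b := Module.Free.chooseBasis ℝ A
  have mul_eq_sum (u v : A) :
      u * v = ∑ ij : _ × _, (b.coord ij.1 u * b.coord ij.2 v) • (b ij.1 * b ij.2) := by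
    conv_lhs => rw [← b.sum_repr u, ← b.sum_repr v]
    simp only [Finset.sum_mul_sum, smul_mul_smul_comm, Fintype.sum_prod_type, b.coord_apply]
  have coord_prod (i j) : ∫ z, b.coord i (F z.1) * b.coord j (G z.2) ∂μ.prod ν =
      b.coord i I * b.coord j J := by
    rw [integral_prod_mul (fun x => b.coord i (F x)) fun y => b.coord j (G y), (hF _).2, (hG _).2]
  have h := of_sum _ (fun ij => b ij.1 * b ij.2) fun ij : _ × _ =>
    (hF (b.coord ij.1)).1.mul_prod (hG (b.coord ij.2)).1
  simpa only [coord_prod, ← mul_eq_sum] using h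

theorem prod_pi [SigmaFinite ν] {F : Y → A} {I : A} (h : HasWeakIntegral ν F I) (n : ℕ) :
    HasWeakIntegral (Measure.pi fun _ : Fin n => ν) (fun x => (List.ofFn fun i => F (x i)).prod)
      (I ^ n) := by
  induction n with
  | zero => simpa only [List.ofFn_zero, List.prod_nil, pow_zero] using pi_zero ν (1 : A)
  | succ n ih =>
    simpa only [List.ofFn_succ, List.prod_cons, pow_succ', Fin.tail] using (h.mul ih).pi_succ

theorem prod_pairs [SigmaFinite ν] {k : Y → Y → ℝ} {F : Y → A} {I : A}
    (h : HasWeakIntegral (ν.prod ν) (fun z => k z.1 z.2 • (F z.1 * F z.2)) I) (M : ℕ) :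
    HasWeakIntegral (Measure.pi fun _ : Fin (2 * M) => ν)
      (fun x => pairWeight k M x • (List.ofFn fun i => F (x i)).prod) (I ^ M) := by
  induction M with
  | zero => simpa [pairWeight] using pi_zero ν (1 : A)
  | succ M ih =>
    rw [pow_succ']
    refine (congrArg (HasWeakIntegral _ · _) (funext fun x => ?_)).mpr (h.mul ih).pi_add_two
    rw [smul_mul_smul_comm, mul_assoc]
    change pairWeight k (M + 1) x • (List.ofFn fun i : Fin (2 * M + 1 + 1) => F (x i)).prod = _
    rw [List.ofFn_succ, List.prod_cons, List.ofFn_succ, List.prod_cons]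
    rfl

end HasWeakIntegral

instance finite_exteriorAlgebra (R : Type*) [CommRing R] (n : ℕ) :
    Module.Finite R (ExteriorAlgebra R (Fin n → R)) :=
  Module.Finite.of_basis (Pi.basisFun R (Fin n)).ExteriorAlgebra

variable {X Y : Type*} [MeasurableSpace X] [MeasurableSpace Y] {n k : ℕ} {μ : Measure X}
  {ν : Measure Y}

theorem FormIntegrable.hasWeakIntegral {F : X → Form n k} (h : FormIntegrable μ F) :
    HasWeakIntegral μ F (formIntegral μ F) := by
  have := HasWeakIntegral.of_sum _ (formBasis n k) h
  simp only [Module.Basis.sum_repr] at this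
  rwa [formIntegral, Module.Basis.equivFun_symm_apply]

theorem HasWeakIntegral.formIntegrable {F : X → Form n k} {I : Form n k}
    (h : HasWeakIntegral μ F I) : FormIntegrable μ F :=
  fun s => (h ((formBasis n k).coord s)).1

theorem HasWeakIntegral.formIntegral_eq {F : X → Form n k} {I : Form n k}
    (h : HasWeakIntegral μ F I) : formIntegral μ F = I :=
  (formBasis n k).ext_elem fun s =>
    (h.formIntegrable.hasWeakIntegral ((formBasis n k).coord s)).2.symm.trans
      (h ((formBasis n k).coord s)).2

theorem formIntegral_formIntegral [SFinite μ] [SFinite ν] {F : X → Y → Form n k}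
    (h : FormIntegrable (μ.prod ν) fun z => F z.1 z.2) :
    (formIntegral ν fun y => formIntegral μ fun x => F x y) =
      formIntegral (μ.prod ν) fun z => F z.1 z.2 := by
  unfold formIntegral
  congr 1
  ext s
  rw [integral_prod_symm _ (h s)]
  refine integral_congr_ae (Filter.Eventually.of_forall fun y => ?_)
  simp only [← Module.Basis.equivFun_apply, LinearEquiv.apply_symm_apply]

theorem hasWeakIntegral_doubleForm {n L : ℕ} {p : Fin n → Polynomial ℝ} {k : ℝ → ℝ → ℝ}
    {ν : Measure ℝ} [SFinite ν]
    (h : FormIntegrable (ν.prod ν) fun z => pairForm L p k z.1 z.2) :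
    HasWeakIntegral (ν.prod ν)
      (fun z => k z.1 z.2 • ((omega L p z.1 : ExteriorAlgebra ℝ (Fin n → ℝ)) * (omega L p z.2)))
      ((2 : ℝ) • (doubleForm L p k ν : ExteriorAlgebra ℝ (Fin n → ℝ))) := by
  rw [doubleForm, formIntegral_formIntegral h, Submodule.coe_smul, smul_smul,
    mul_one_div_cancel two_ne_zero, one_smul]
  exact h.hasWeakIntegral.map (Submodule.subtype _)

end WeakIntegral

section Moments

theorem ae_lintegral_update_ne_top {n : ℕ} {X : Fin (n + 1) → Type*} [∀ i, MeasurableSpace (X i)]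
    (μ : ∀ i, Measure (X i)) [∀ i, SigmaFinite (μ i)] {f : (∀ i, X i) → ENNReal}
    (hf : Measurable f) (hfin : ∫⁻ x, f x ∂Measure.pi μ ≠ ⊤) (i : Fin (n + 1)) :
    ∀ᵐ x ∂Measure.pi μ, ∫⁻ t, f (Function.update x i t) ∂μ i ≠ ⊤ := by
  have split := measurePreserving_piFinSuccAbove μ i
  set E := MeasurableEquiv.piFinSuccAbove X i
  have measurable_f_symm : Measurable fun z => f (E.symm z) := hf.comp E.symm.measurable
  have lintegral_eq : ∫⁻ x, f x ∂Measure.pi μ =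
      ∫⁻ y, ∫⁻ t, f (E.symm (t, y)) ∂μ i ∂Measure.pi fun j => μ (i.succAbove j) := by
    rw [← lintegral_prod_symm' _ measurable_f_symm, ← split.lintegral_comp measurable_f_symm]
    simp only [E.symm_apply_apply]
  have ae_section := ae_lt_top measurable_f_symm.lintegral_prod_left' (lintegral_eq ▸ hfin)
  filter_upwards [split.quasiMeasurePreserving.ae
    (Measure.quasiMeasurePreserving_snd.ae ae_section)] with x hx
  have symm_eq_update (t : X i) : E.symm (t, (E x).2) = Function.update x i t := by
    simp [E, MeasurableEquiv.piFinSuccAbove, Fin.insertNthEquiv]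
  simpa only [symm_eq_update] using hx.ne

theorem exists_ne_zero_forall_lintegral_update_ne_top {n : ℕ} {X : Fin (n + 1) → Type*}
    [∀ i, MeasurableSpace (X i)] (μ : ∀ i, Measure (X i)) [∀ i, SigmaFinite (μ i)]
    {f : (∀ i, X i) → ENNReal} (hf : Measurable f) (hpos : ∫⁻ x, f x ∂Measure.pi μ ≠ 0)
    (hfin : ∫⁻ x, f x ∂Measure.pi μ ≠ ⊤) :
    ∃ x, f x ≠ 0 ∧ ∀ i, ∫⁻ t, f (Function.update x i t) ∂μ i ≠ ⊤ := by
  have frequently_ne_zero : ∃ᵐ x ∂Measure.pi μ, f x ≠ 0 := fun h =>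
    hpos ((lintegral_eq_zero_iff hf).2 (h.mono fun _ => not_not.1))
  exact (frequently_ne_zero.and_eventually
    (ae_all_iff.2 (ae_lintegral_update_ne_top μ hf hfin))).exists

theorem prod_abs_sub_pow {N : ℕ} (β : ℕ) (x : Fin N → ℝ) :
    ∏ m, ∏ n ∈ Finset.Ioi m, |x n - x m| ^ β = |(Matrix.vandermonde x).det| ^ β := by
  rw [Matrix.det_vandermonde, Finset.abs_prod]
  simp only [Finset.abs_prod, Finset.prod_pow]

theorem continuous_det_vandermonde (N : ℕ) :
    Continuous fun x : Fin N → ℝ => (Matrix.vandermonde x).det := by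
  simp only [Matrix.det_vandermonde]
  fun_prop

theorem pow_mul_det_vandermonde {R : Type*} [CommRing R] {N : ℕ} (x : Fin N → R) (t : R)
    (k : Fin N) :
    t ^ (k : ℕ) * (Matrix.vandermonde x).det =
      ∑ i, x i ^ (k : ℕ) * (Matrix.vandermonde (Function.update x i t)).det := by
  have cramer_eq (i : Fin N) : (Matrix.vandermonde x).transpose.cramer (fun l => t ^ (l : ℕ)) i =
      (Matrix.vandermonde (Function.update x i t)).det := by
    rw [Matrix.cramer_apply, Matrix.updateCol_transpose, Matrix.det_transpose]
    congr 1
    ext j l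
    rcases eq_or_ne j i with rfl | hj
    · simp [Matrix.vandermonde_apply]
    · simp [Matrix.vandermonde_apply, hj]
  have h := congrFun (Matrix.mulVec_cramer (Matrix.vandermonde x).transpose
    fun l : Fin N => t ^ (l : ℕ)) k
  simp only [Matrix.mulVec, dotProduct, cramer_eq, Matrix.det_transpose, Pi.smul_apply,
    smul_eq_mul, Matrix.transpose_apply, Matrix.vandermonde_apply] at h
  rw [mul_comm, ← h]

variable {N β : ℕ} {ν : Measure ℝ} [SigmaFinite ν]

theorem exists_memLp_det_vandermonde_update (hβ : β ≠ 0) (hpos : 0 < partitionFunction N β ν)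
    (hfin : partitionFunction N β ν < ⊤) :
    ∃ x : Fin N → ℝ, (Matrix.vandermonde x).det ≠ 0 ∧
      ∀ i, MemLp (fun t => (Matrix.vandermonde (Function.update x i t)).det) β ν := by
  cases N with
  | zero => exact ⟨0, by simp, fun i => i.elim0⟩
  | succ n =>
    simp only [partitionFunction, prod_abs_sub_pow] at hpos hfin
    have factorial_inv_ne_zero : ((n + 1).factorial : ENNReal)⁻¹ ≠ 0 := by simp
    have measurable_weight : Measurable fun x : Fin (n + 1) → ℝ =>
        ENNReal.ofReal (|(Matrix.vandermonde x).det| ^ β) :=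
      ENNReal.measurable_ofReal.comp ((continuous_det_vandermonde _).abs.pow β).measurable
    obtain ⟨x, hx, hint⟩ := exists_ne_zero_forall_lintegral_update_ne_top (fun _ => ν)
      measurable_weight (right_ne_zero_of_mul hpos.ne')
      fun h => hfin.ne (by rw [h, ENNReal.mul_top factorial_inv_ne_zero])
    refine ⟨x, fun h => hx (by simp [h, hβ]), fun i => ?_⟩
    have continuous_update : Continuous fun t =>
        (Matrix.vandermonde (Function.update x i t)).det :=
      (continuous_det_vandermonde _).comp (continuous_const.update i continuous_id)
    rw [← integrable_norm_rpow_iff continuous_update.aestronglyMeasurable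
      (Nat.cast_ne_zero.2 hβ) (ENNReal.natCast_ne_top β)]
    simp only [ENNReal.toReal_natCast, Real.rpow_natCast, Real.norm_eq_abs]
    refine ⟨(continuous_update.abs.pow β).aestronglyMeasurable, ?_⟩
    rw [hasFiniteIntegral_iff_ofReal (Filter.Eventually.of_forall fun t => by positivity)]
    exact (hint i).lt_top

theorem memLp_pow_of_partitionFunction (hβ : β ≠ 0) (hpos : 0 < partitionFunction N β ν)
    (hfin : partitionFunction N β ν < ⊤) (k : Fin N) : MemLp (fun t => t ^ (k : ℕ)) β ν := by
  obtain ⟨x, hx, hmem⟩ := exists_memLp_det_vandermonde_update hβ hpos hfin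
  have pow_eq (t : ℝ) : t ^ (k : ℕ) = (Matrix.vandermonde x).det⁻¹ *
      ∑ i, x i ^ (k : ℕ) * (Matrix.vandermonde (Function.update x i t)).det := by
    rw [← pow_mul_det_vandermonde, mul_comm (t ^ _), inv_mul_cancel_left₀ hx]
  have h := (memLp_finsetSum Finset.univ fun i _ => (hmem i).const_mul (x i ^ (k : ℕ))).const_mul
    (Matrix.vandermonde x).det⁻¹
  simpa only [← pow_eq] using h

theorem integrable_eval_of_natDegree_le (hN : 0 < N) (hβ : β ≠ 0)
    (hpos : 0 < partitionFunction N β ν) (hfin : partitionFunction N β ν < ⊤)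
    {q : Polynomial ℝ} (hq : q.natDegree ≤ β * (N - 1)) : Integrable (fun t => q.eval t) ν := by
  have : IsFiniteMeasure ν := by
    have h := memLp_pow_of_partitionFunction hβ hpos hfin ⟨0, hN⟩
    simpa [memLp_const_iff, hβ, isFiniteMeasure_iff] using h
  have integrable_top := (memLp_pow_of_partitionFunction hβ hpos hfin
    ⟨N - 1, Nat.sub_lt hN one_pos⟩).integrable_norm_pow hβ
  simp only [norm_pow, ← pow_mul, mul_comm (N - 1)] at integrable_top
  simp only [Polynomial.eval_eq_sum_range]
  refine integrable_finsetSum _ fun j hj => Integrable.const_mul ?_ _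
  have h := integrable_norm_pow_of_le aestronglyMeasurable_id
    ((Finset.mem_range_succ_iff.1 hj).trans hq) integrable_top
  simp only [id, ← norm_pow] at h
  exact (integrable_norm_iff (by fun_prop)).1 h

end Moments

section WronskianIntegrability

open Polynomial

theorem natDegree_det_le_sum_sub_sum {R ι : Type*} [CommRing R] [Fintype ι] [DecidableEq ι]
    {A : Matrix ι ι R[X]} {d c : ι → ℕ}
    (h : ∀ i j, A i j ≠ 0 → (A i j).natDegree + c j ≤ d i) :
    A.det.natDegree ≤ ∑ i, d i - ∑ j, c j := by
  rw [Matrix.det_apply]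
  refine natDegree_sum_le_of_forall_le _ _ fun σ _ => (natDegree_smul_le _ _).trans ?_
  by_cases hzero : ∃ j, A (σ j) j = 0
  · obtain ⟨j, hj⟩ := hzero
    rw [Finset.prod_eq_zero (f := fun i => A (σ i) i) (Finset.mem_univ j) hj, natDegree_zero]
    exact Nat.zero_le _
  · push Not at hzero
    refine (natDegree_prod_le _ _).trans (Nat.le_sub_of_add_le ?_)
    rw [← Finset.sum_add_distrib, ← Equiv.sum_comp σ d]
    exact Finset.sum_le_sum fun j _ => h _ _ (hzero j)

theorem orderEmbedding_add_le {n L : ℕ} (t : Fin L ↪o Fin n) (l : Fin L) :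
    (t l : ℕ) + L ≤ n + l := by
  have h := Finset.card_le_card_of_injOn (s := Finset.Ioi l) (t := Finset.Ioi (t l)) t
    (fun i hi => by simpa using hi) t.injective.injOn
  simp only [Fin.card_Ioi] at h
  omega

/-- The normalized Wronskian as a polynomial, with Hasse derivatives in place of the derivatives
divided by factorials. -/
def wronskianPoly {R : Type*} [CommRing R] {n L : ℕ} (p : Fin n → R[X]) (t : Fin L → Fin n) :
    R[X] :=
  Matrix.det (Matrix.of fun i l : Fin L => hasseDeriv l (p (t i)))

theorem eval_wronskianPoly {n L : ℕ} (p : Fin n → ℝ[X]) (t : Fin L → Fin n) (x : ℝ) :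
    (wronskianPoly p t).eval x = wronskian p t x := by
  rw [wronskian_eq_det_jet, wronskianPoly, ← coe_evalRingHom, RingHom.map_det]
  congr 1
  ext i l
  simp [jet, taylor_coeff]

theorem natDegree_wronskianPoly_le {R : Type*} [CommRing R] {n L : ℕ} {p : Fin n → R[X]}
    (hp : ∀ i, (p i).natDegree ≤ i) (t : Fin L ↪o Fin n) :
    (wronskianPoly p t).natDegree ≤ L * (n - L) := by
  have entry_le (i l : Fin L) (h : hasseDeriv l (p (t i)) ≠ 0) :
      (hasseDeriv l (p (t i))).natDegree + l ≤ t i := by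
    have le_natDegree : (l : ℕ) ≤ (p (t i)).natDegree := not_lt.1 fun hlt =>
      h (hasseDeriv_eq_zero_of_lt_natDegree _ _ hlt)
    have := natDegree_hasseDeriv_le (p (t i)) l
    have := hp (t i)
    omega
  have sum_le : ∑ i, (t i : ℕ) ≤ L * (n - L) + ∑ l : Fin L, (l : ℕ) := by
    calc ∑ i, (t i : ℕ) ≤ ∑ l : Fin L, (n - L + l) := Finset.sum_le_sum fun l _ => by
          have := orderEmbedding_add_le t l
          omega
      _ = L * (n - L) + ∑ l : Fin L, (l : ℕ) := by simp [Finset.sum_add_distrib]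
  exact (natDegree_det_le_sum_sub_sum entry_le).trans (Nat.sub_le_of_le_add sum_le)

theorem pairForm_eq_sum {n : ℕ} (L : ℕ) (p : Fin n → ℝ[X]) (k : ℝ → ℝ → ℝ) (x y : ℝ) :
    pairForm L p k x y = ∑ ts : (Fin L ↪o Fin n) × (Fin L ↪o Fin n),
      (k x y * (wronskian p ts.1 x * wronskian p ts.2 y)) •
        wedge (basicForm ts.1) (basicForm ts.2) := by
  apply Subtype.ext
  simp only [pairForm, wedge, omega, Submodule.coe_smul, AddSubmonoidClass.coe_finsetSum,
    Fintype.sum_prod_type, Finset.sum_mul_sum, Finset.smul_sum, smul_mul_smul_comm, smul_smul]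

theorem formIntegrable_pairForm {n L : ℕ} {p : Fin n → ℝ[X]} {k : ℝ → ℝ → ℝ} {ν : Measure ℝ}
    (h : ∀ t s : Fin L ↪o Fin n, Integrable
      (fun z : ℝ × ℝ => k z.1 z.2 * (wronskian p t z.1 * wronskian p s z.2)) (ν.prod ν)) :
    FormIntegrable (ν.prod ν) fun z => pairForm L p k z.1 z.2 := by
  simp only [pairForm_eq_sum]
  exact (HasWeakIntegral.of_sum _ _ fun ts : _ × _ => h ts.1 ts.2).formIntegrable

theorem measurable_sign : Measurable Real.sign := by
  unfold Real.sign
  exact Measurable.ite measurableSet_Iio measurable_const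
    (Measurable.ite measurableSet_Ioi measurable_const measurable_const)

variable {N L β : ℕ} {ν : Measure ℝ} [SigmaFinite ν] {p : Fin (N * L) → ℝ[X]}

theorem integrable_pow_mul_wronskian (hN : 0 < N) (hβ : β ≠ 0)
    (hpos : 0 < partitionFunction N β ν) (hfin : partitionFunction N β ν < ⊤)
    (hp : IsCompleteMonic p) {j : ℕ} (hj : L ^ 2 * (N - 1) + j ≤ β * (N - 1))
    (t : Fin L ↪o Fin (N * L)) : Integrable (fun x => x ^ j * wronskian p t x) ν := by
  have natDegree_le : (X ^ j * wronskianPoly p t).natDegree ≤ β * (N - 1) := by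
    refine (natDegree_mul_le_of_le (natDegree_X_pow_le j)
      (natDegree_wronskianPoly_le (fun i => (hp i).2.le) t)).trans ?_
    rwa [← Nat.sub_one_mul, mul_comm (N - 1), ← mul_assoc, ← sq, add_comm]
  simpa [eval_wronskianPoly] using integrable_eval_of_natDegree_le hN hβ hpos hfin natDegree_le

theorem integrable_wronskian (hN : 0 < N) (hL : 0 < L)
    (hpos : 0 < partitionFunction N (L ^ 2) ν) (hfin : partitionFunction N (L ^ 2) ν < ⊤)
    (hp : IsCompleteMonic p) (t : Fin L ↪o Fin (N * L)) : Integrable (wronskian p t) ν := by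
  simpa only [pow_zero, one_mul] using
    integrable_pow_mul_wronskian hN (pow_pos hL 2).ne' hpos hfin hp (j := 0) le_rfl t

theorem formIntegrable_omega (hN : 0 < N) (hL : 0 < L)
    (hpos : 0 < partitionFunction N (L ^ 2) ν) (hfin : partitionFunction N (L ^ 2) ν < ⊤)
    (hp : IsCompleteMonic p) : FormIntegrable ν (omega L p) :=
  (HasWeakIntegral.of_sum _ (fun t : Fin L ↪o Fin (N * L) => basicForm t)
    (integrable_wronskian hN hL hpos hfin hp)).formIntegrable

theorem formIntegrable_pairForm_sign (hN : 0 < N) (hL : 0 < L)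
    (hpos : 0 < partitionFunction N (L ^ 2) ν) (hfin : partitionFunction N (L ^ 2) ν < ⊤)
    (hp : IsCompleteMonic p) :
    FormIntegrable (ν.prod ν) fun z => pairForm L p (fun x y => Real.sign (y - x)) z.1 z.2 := by
  have h := integrable_wronskian hN hL hpos hfin hp
  refine formIntegrable_pairForm fun t s => ((h t).mul_prod (h s)).bdd_mul (c := 1) ?_ ?_
  · exact (measurable_sign.comp (measurable_snd.sub measurable_fst)).aestronglyMeasurable
  · refine Filter.Eventually.of_forall fun z => ?_
    rcases Real.sign_apply_eq (z.2 - z.1) with h | h | h <;> simp [h]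

theorem formIntegrable_pairForm_sq_pow_sub_pow {M : ℕ} (hM : N = 2 * M) (hN : 0 < N)
    (hpos : 0 < partitionFunction N (L ^ 2 + 1) ν)
    (hfin : partitionFunction N (L ^ 2 + 1) ν < ⊤) (hp : IsCompleteMonic p) :
    FormIntegrable (ν.prod ν)
      fun z => pairForm L p (fun x y => (y ^ M - x ^ M) ^ 2 / (y - x)) z.1 z.2 := by
  have h {j : ℕ} (hj : j ≤ N - 1) (t : Fin L ↪o Fin (N * L)) :
      Integrable (fun x => x ^ j * wronskian p t x) ν :=
    integrable_pow_mul_wronskian hN (Nat.add_one_ne_zero _) hpos hfin hp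
      (by rw [add_mul, one_mul]; omega) t
  refine formIntegrable_pairForm fun t s => ?_
  simp only [sq_pow_sub_pow_div_sub, Finset.sum_mul]
  refine integrable_finsetSum _ fun a ha => ?_
  have ha' : a ≤ N - 1 := by rw [Finset.mem_range] at ha; omega
  have hb : 2 * M - 1 - a ≤ N - 1 := by omega
  refine (((h ha' t).mul_prod (h hb s)).sub ((h hb t).mul_prod (h ha' s))).congr
    (Filter.Eventually.of_forall fun z => ?_)
  simp only [Pi.sub_apply]
  ring

end WronskianIntegrability

section SymmetrizedIntegrals

theorem toReal_partitionFunction (N β : ℕ) (ν : Measure ℝ) :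
    (partitionFunction N β ν).toReal = (N.factorial : ℝ)⁻¹ *
      ∫ x : Fin N → ℝ, |(Matrix.vandermonde x).det| ^ β ∂(Measure.pi fun _ => ν) := by
  simp only [partitionFunction, prod_abs_sub_pow]
  have continuous_weight : Continuous fun x : Fin N → ℝ => |(Matrix.vandermonde x).det| ^ β :=
    (continuous_det_vandermonde N).abs.pow β
  rw [ENNReal.toReal_mul, ENNReal.toReal_inv, ENNReal.toReal_natCast,
    integral_eq_lintegral_of_nonneg_ae (Filter.Eventually.of_forall fun x => by positivity)
      continuous_weight.aestronglyMeasurable]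

theorem factorial_mul_integral_mul_of_comp_perm {X : Type*} [MeasurableSpace X] {n : ℕ}
    {ν : Measure X} [SigmaFinite ν] {w D : (Fin n → X) → ℝ}
    (hD : ∀ x (σ : Equiv.Perm (Fin n)), D (x ∘ σ) = Equiv.Perm.sign σ • D x)
    (hw : Integrable (fun x => w x * D x) (Measure.pi fun _ => ν)) :
    n.factorial * ∫ x, w x * D x ∂(Measure.pi fun _ => ν) =
      ∫ x, antisymmetrization w x * D x ∂(Measure.pi fun _ => ν) := by
  have permute (σ : Equiv.Perm (Fin n)) : MeasurePreserving (· ∘ σ)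
      (Measure.pi fun _ : Fin n => ν) (Measure.pi fun _ => ν) :=
    measurePreserving_arrowCongr' (fun _ => ν) (fun _ => ν) σ.symm (MeasurableEquiv.refl X)
      fun _ => MeasurePreserving.id ν
  have embed (σ : Equiv.Perm (Fin n)) : MeasurableEmbedding fun x : Fin n → X => x ∘ σ :=
    (MeasurableEquiv.arrowCongr' σ.symm (MeasurableEquiv.refl X)).measurableEmbedding
  have signed_term (σ : Equiv.Perm (Fin n)) (x : Fin n → X) :
      Equiv.Perm.sign σ • w (x ∘ σ) * D x = w (x ∘ σ) * D (x ∘ σ) := by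
    rw [hD, smul_mul_assoc, mul_smul_comm]
  have integrable_term (σ : Equiv.Perm (Fin n)) :
      Integrable (fun x => w (x ∘ σ) * D (x ∘ σ)) (Measure.pi fun _ => ν) :=
    ((permute σ).integrable_comp_emb (embed σ)).2 hw
  simp only [antisymmetrization, Finset.sum_mul, signed_term]
  rw [integral_finsetSum _ fun σ _ => integrable_term σ,
    Finset.sum_congr rfl fun σ _ => (permute σ).integral_comp (embed σ) fun x => w x * D x]
  simp [Fintype.card_perm]

theorem det_vandermonde_comp_perm_pow {R : Type*} [CommRing R] {n q : ℕ} (hq : Odd q)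
    (x : Fin n → R) (σ : Equiv.Perm (Fin n)) :
    (Matrix.vandermonde (x ∘ σ)).det ^ q = Equiv.Perm.sign σ • (Matrix.vandermonde x).det ^ q := by
  rw [det_vandermonde_comp_perm, smul_pow]
  congr 1
  rcases Int.units_eq_one_or (Equiv.Perm.sign σ) with h | h <;> simp [h, hq.neg_one_pow]

theorem integral_mul_det_vandermonde_pow {N q β : ℕ} (hq : Odd q) {ν : Measure ℝ} [SigmaFinite ν]
    {w : (Fin N → ℝ) → ℝ} {c : ℝ}
    (hw : Integrable (fun x => w x * (Matrix.vandermonde x).det ^ q) (Measure.pi fun _ => ν))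
    (hc : ∀ x, antisymmetrization w x * (Matrix.vandermonde x).det ^ q =
      c * |(Matrix.vandermonde x).det| ^ β) :
    ∫ x, w x * (Matrix.vandermonde x).det ^ q ∂(Measure.pi fun _ => ν) =
      c * (partitionFunction N β ν).toReal := by
  have h := factorial_mul_integral_mul_of_comp_perm (det_vandermonde_comp_perm_pow hq) hw
  simp only [hc] at h
  rw [integral_const_mul] at h
  rw [toReal_partitionFunction]
  field_simp
  linear_combination h

theorem sign_mul_pow_of_odd {q : ℕ} (hq : Odd q) (d : ℝ) : Real.sign d * d ^ q = |d| ^ q := by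
  rcases lt_trichotomy d 0 with h | rfl | h
  · rw [Real.sign_of_neg h, abs_of_neg h, hq.neg_pow, neg_one_mul]
  · simp [hq.pos.ne']
  · rw [Real.sign_of_pos h, abs_of_pos h, one_mul]

theorem antisymmetrization_mul_det_vandermonde_pow {N q : ℕ} (hq : Odd q) {w : (Fin N → ℝ) → ℝ}
    {c : ℝ} (h : ∀ x, Function.Injective x →
      antisymmetrization w x = c * Real.sign (Matrix.vandermonde x).det) (x : Fin N → ℝ) :
    antisymmetrization w x * (Matrix.vandermonde x).det ^ q =
      c * |(Matrix.vandermonde x).det| ^ q := by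
  by_cases hx : Function.Injective x
  · rw [h x hx, mul_assoc, sign_mul_pow_of_odd hq]
  · rw [← Matrix.det_vandermonde_ne_zero_iff, not_not] at hx
    simp [hx, hq.pos.ne']

end SymmetrizedIntegrals

section UnborderedFormulas

variable {L β : ℕ} {ν : Measure ℝ} [SigmaFinite ν]

theorem hyperpfaffian_formIntegral_omega {N : ℕ} (hL : 0 < L) (hL2 : Even (L ^ 2))
    {p : Fin (N * L) → Polynomial ℝ} (hp : IsCompleteMonic p)
    (hint : FormIntegrable ν (omega L p)) :
    hyperpfaffian (formIntegral ν (omega L p)) = (partitionFunction N (L ^ 2) ν).toReal := by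
  have volCoeff_pow : ∫ x : Fin N → ℝ, (Matrix.vandermonde x).det ^ L ^ 2 ∂(Measure.pi fun _ => ν) =
      volCoeff (N * L)
        ((formIntegral ν (omega L p) : ExteriorAlgebra ℝ (Fin (N * L) → ℝ)) ^ N) := by
    simp only [← volCoeff_prod_omega hp]
    exact ((hint.hasWeakIntegral.map (Submodule.subtype _)).prod_pi N (volCoeff (N * L))).2
  rw [hyperpfaffian, Nat.mul_div_cancel _ hL, map_smul, smul_eq_mul, ← volCoeff_pow,
    toReal_partitionFunction]
  simp only [hL2.pow_abs]

theorem hasWeakIntegral_doubleForm_pow {n : ℕ} {p : Fin n → Polynomial ℝ} {k : ℝ → ℝ → ℝ}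
    (hint : FormIntegrable (ν.prod ν) fun z => pairForm L p k z.1 z.2) (M : ℕ) :
    HasWeakIntegral (Measure.pi fun _ : Fin (2 * M) => ν)
      (fun x => pairWeight k M x • (List.ofFn fun i =>
        (omega L p (x i) : ExteriorAlgebra ℝ (Fin n → ℝ))).prod)
      ((2 : ℝ) ^ M • (doubleForm L p k ν : ExteriorAlgebra ℝ (Fin n → ℝ)) ^ M) := by
  rw [← smul_pow]
  exact HasWeakIntegral.prod_pairs (k := k)
    (F := fun x => (omega L p x : ExteriorAlgebra ℝ (Fin n → ℝ)))
    (hasWeakIntegral_doubleForm hint) M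

theorem volCoeff_doubleForm_pow {M : ℕ} (hL2 : Odd (L ^ 2))
    {p : Fin (2 * M * L) → Polynomial ℝ} (hp : IsCompleteMonic p) {k : ℝ → ℝ → ℝ}
    (hint : FormIntegrable (ν.prod ν) fun z => pairForm L p k z.1 z.2)
    (hk : ∀ x : Fin (2 * M) → ℝ, antisymmetrization (pairWeight k M) x *
      (Matrix.vandermonde x).det ^ L ^ 2 =
        2 ^ M * M.factorial * |(Matrix.vandermonde x).det| ^ β) :
    volCoeff (2 * M * L)
        ((doubleForm L p k ν : ExteriorAlgebra ℝ (Fin (2 * M * L) → ℝ)) ^ M) =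
      M.factorial * (partitionFunction (2 * M) β ν).toReal := by
  have h := hasWeakIntegral_doubleForm_pow hint M (volCoeff (2 * M * L))
  simp only [map_smul, smul_eq_mul, volCoeff_prod_omega hp] at h
  rw [integral_mul_det_vandermonde_pow hL2 h.1 hk, mul_assoc] at h
  exact (mul_left_cancel₀ (pow_ne_zero M two_ne_zero) h.2).symm

theorem hyperpfaffian_doubleForm {M : ℕ} (hL2 : Odd (L ^ 2))
    {p : Fin (2 * M * L) → Polynomial ℝ} (hp : IsCompleteMonic p) {k : ℝ → ℝ → ℝ}
    (hint : FormIntegrable (ν.prod ν) fun z => pairForm L p k z.1 z.2)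
    (hk : ∀ x : Fin (2 * M) → ℝ, antisymmetrization (pairWeight k M) x *
      (Matrix.vandermonde x).det ^ L ^ 2 =
        2 ^ M * M.factorial * |(Matrix.vandermonde x).det| ^ β) :
    hyperpfaffian (doubleForm L p k ν) = (partitionFunction (2 * M) β ν).toReal := by
  have hL : 0 < L := Nat.pos_of_ne_zero fun h => by simp [h] at hL2
  have degree : 2 * M * L / (L + L) = M := by
    rw [show 2 * M * L = M * (L + L) by ring, Nat.mul_div_cancel _ (by omega)]
  rw [hyperpfaffian, degree, map_smul, smul_eq_mul, volCoeff_doubleForm_pow hL2 hp hint hk,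
    inv_mul_cancel_left₀ (Nat.cast_ne_zero.2 M.factorial_ne_zero)]

theorem volCoeff_omega_mul_doubleForm_pow {M : ℕ} (hL2 : Odd (L ^ 2))
    {p : Fin ((2 * M + 1) * L) → Polynomial ℝ} (hp : IsCompleteMonic p)
    (hω : FormIntegrable ν (omega L p)) {k : ℝ → ℝ → ℝ}
    (hint : FormIntegrable (ν.prod ν) fun z => pairForm L p k z.1 z.2)
    (hk : ∀ x : Fin (2 * M + 1) → ℝ,
      antisymmetrization (fun y => pairWeight k M (Fin.tail y)) x *
        (Matrix.vandermonde x).det ^ L ^ 2 =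
          2 ^ M * M.factorial * |(Matrix.vandermonde x).det| ^ β) :
    volCoeff ((2 * M + 1) * L)
        ((formIntegral ν (omega L p) : ExteriorAlgebra ℝ (Fin ((2 * M + 1) * L) → ℝ)) *
          (doubleForm L p k ν : ExteriorAlgebra ℝ (Fin ((2 * M + 1) * L) → ℝ)) ^ M) =
      M.factorial * (partitionFunction (2 * M + 1) β ν).toReal := by
  have volCoeff_split (x : Fin (2 * M + 1) → ℝ) : volCoeff ((2 * M + 1) * L)
      (Submodule.subtype _ (omega L p (x 0)) *
        (pairWeight k M (Fin.tail x) • (List.ofFn fun i =>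
          (omega L p (Fin.tail x i) : ExteriorAlgebra ℝ (Fin ((2 * M + 1) * L) → ℝ))).prod)) =
      pairWeight k M (Fin.tail x) * (Matrix.vandermonde x).det ^ L ^ 2 := by
    rw [← volCoeff_prod_omega hp, mul_smul_comm, map_smul, smul_eq_mul, List.ofFn_succ,
      List.prod_cons]
    rfl
  have h := ((hω.hasWeakIntegral.map (Submodule.subtype _)).mul
    (hasWeakIntegral_doubleForm_pow hint M)).pi_succ (volCoeff ((2 * M + 1) * L))
  simp only [volCoeff_split] at h
  rw [mul_smul_comm, map_smul, smul_eq_mul,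
    integral_mul_det_vandermonde_pow hL2 h.1 hk, mul_assoc] at h
  exact (mul_left_cancel₀ (pow_ne_zero M two_ne_zero) h.2).symm

end UnborderedFormulas

section Border

theorem eq_zero_of_mem_exteriorPower_of_lt {n m : ℕ} (h : n < m)
    {a : ExteriorAlgebra ℝ (Fin n → ℝ)} (ha : a ∈ ⋀[ℝ]^m (Fin n → ℝ)) : a = 0 := by
  have empty_basis : IsEmpty (Set.powersetCard (Fin n) m) := by
    rw [Set.isEmpty_coe_sort]
    ext s
    have := Finset.card_le_univ s
    simp only [Fintype.card_fin] at this
    simp [Set.powersetCard]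
    omega
  exact congrArg Subtype.val
    ((formBasis n m).ext_elem (x := ⟨a, ha⟩) (y := 0) fun s => isEmptyElim s)

theorem coe_pow_mem_exteriorPower {n k : ℕ} (a : Form n k) (m : ℕ) :
    (a : ExteriorAlgebra ℝ (Fin n → ℝ)) ^ m ∈ ⋀[ℝ]^(m * k) (Fin n → ℝ) :=
  SetLike.pow_mem_graded (A := fun i : ℕ => ⋀[ℝ]^i (Fin n → ℝ)) m a.2

theorem coe_pow_eq_zero_of_lt {n k m : ℕ} (h : n < m * k) (a : Form n k) :
    (a : ExteriorAlgebra ℝ (Fin n → ℝ)) ^ m = 0 :=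
  eq_zero_of_mem_exteriorPower_of_lt h (coe_pow_mem_exteriorPower a m)

/-- The inclusion `ℝ^{NL} → ℝ^{(N+1)L}`, `e_i ↦ e_i`, that induces `extendForm`. -/
def inclusion (N L : ℕ) : (Fin (N * L) → ℝ) →ₗ[ℝ] (Fin ((N + 1) * L) → ℝ) :=
  Function.ExtendByZero.linearMap ℝ
    (Fin.castLE (Nat.mul_le_mul_right L (Nat.le_succ N)) : Fin (N * L) → Fin ((N + 1) * L))

variable {N L : ℕ}

theorem inclusion_e (i : Fin (N * L)) :
    inclusion N L (e i) = e (Fin.castLE (Nat.mul_le_mul_right L (Nat.le_succ N)) i) := by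
  have castLE_injective := Fin.castLE_injective (Nat.mul_le_mul_right L (Nat.le_succ N))
  ext j
  change Function.extend _ (e i) (0 : Fin ((N + 1) * L) → ℝ) j = _
  by_cases hj : ∃ i', Fin.castLE (Nat.mul_le_mul_right L (Nat.le_succ N)) i' = j
  · obtain ⟨i', rfl⟩ := hj
    rw [castLE_injective.extend_apply]
    simp [e, Pi.single_apply]
  · rw [Function.extend_apply' _ _ _ hj]
    have ne_image : j ≠ Fin.castLE (Nat.mul_le_mul_right L (Nat.le_succ N)) i :=
      fun h => hj ⟨i, h.symm⟩
    simp [e, ne_image]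

theorem coe_extendForm {k : ℕ} (a : Form (N * L) k) :
    (extendForm N L a : ExteriorAlgebra ℝ (Fin ((N + 1) * L) → ℝ)) =
      ExteriorAlgebra.map (inclusion N L) (a : ExteriorAlgebra ℝ (Fin (N * L) → ℝ)) := by
  have eq_maps : Submodule.subtype _ ∘ₗ extendForm N L =
      (ExteriorAlgebra.map (inclusion N L)).toLinearMap ∘ₗ
        Submodule.subtype (⋀[ℝ]^k (Fin (N * L) → ℝ)) := by
    ext v : 2
    change ((extendForm N L (exteriorPower.ιMulti ℝ k v) : Form _ k) : ExteriorAlgebra ℝ _) =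
      ExteriorAlgebra.map (inclusion N L)
        ((exteriorPower.ιMulti ℝ k v : Form _ k) : ExteriorAlgebra ℝ _)
    rw [extendForm, exteriorPower.map_apply_ιMulti, exteriorPower.ιMulti_apply_coe,
      exteriorPower.ιMulti_apply_coe, ExteriorAlgebra.map_apply_ιMulti]
    rfl
  exact LinearMap.congr_fun eq_maps a

theorem coe_basicForm {n k : ℕ} (t : Fin k → Fin n) :
    (basicForm t : ExteriorAlgebra ℝ (Fin n → ℝ)) =
      ExteriorAlgebra.ιMulti ℝ k fun i => e (t i) := by
  rw [basicForm, exteriorPower.ιMulti_apply_coe]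

theorem map_volForm_mul_borderForm :
    ExteriorAlgebra.map (inclusion N L) (volForm (N * L)) * borderForm N L =
      volForm ((N + 1) * L) := by
  rw [volForm, volForm, borderForm, coe_basicForm, ExteriorAlgebra.map_apply_ιMulti]
  simp only [ExteriorAlgebra.ιMulti_apply, Function.comp_apply, inclusion_e]
  rw [List.ofFn_congr (Nat.succ_mul N L), List.ofFn_add, List.prod_append]
  rfl

theorem volCoeff_map_mul_borderForm {a : ExteriorAlgebra ℝ (Fin (N * L) → ℝ)}
    (ha : a ∈ ⋀[ℝ]^(N * L) (Fin (N * L) → ℝ)) :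
    volCoeff ((N + 1) * L) (ExteriorAlgebra.map (inclusion N L) a * borderForm N L) =
      volCoeff (N * L) a := by
  conv_lhs => rw [eq_volCoeff_smul ha]
  rw [map_smul, smul_mul_assoc, map_smul, map_volForm_mul_borderForm, volCoeff_volForm,
    smul_eq_mul, mul_one]

theorem ιMulti_mul_self {R V : Type*} [CommRing R] [AddCommGroup V] [Module R V] {n : ℕ}
    (hn : 0 < n) (v : Fin n → V) :
    ExteriorAlgebra.ιMulti R n v * ExteriorAlgebra.ιMulti R n v = 0 := by
  obtain ⟨m, rfl⟩ := Nat.exists_eq_add_one.2 hn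
  nth_rewrite 1 [ιMulti_succ_apply_last]
  rw [mul_assoc, ι_mul_ιMulti_eq_zero, mul_zero]

/-- The linear map `a ↦ a ∧ ε'`, where `a` is regarded as a form on `ℝ^{(N+1)L}`. -/
def wedgeBorder (N L : ℕ) : Form (N * L) L →ₗ[ℝ] Form ((N + 1) * L) (L + L) where
  toFun a := wedge (extendForm N L a) (borderForm N L)
  map_add' a b := Subtype.ext (by simp [wedge, add_mul])
  map_smul' c a := Subtype.ext (by simp [wedge])

theorem coe_wedgeBorder (a : Form (N * L) L) :
    (wedgeBorder N L a : ExteriorAlgebra ℝ (Fin ((N + 1) * L) → ℝ)) =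
      ExteriorAlgebra.map (inclusion N L) (a : ExteriorAlgebra ℝ (Fin (N * L) → ℝ)) *
        borderForm N L := by
  rw [← coe_extendForm]
  rfl

theorem commute_wedgeBorder (a : Form (N * L) L)
    (b : ExteriorAlgebra ℝ (Fin ((N + 1) * L) → ℝ)) : Commute ↑(wedgeBorder N L a) b :=
  commute_of_mem_even ⟨L, rfl⟩ (wedgeBorder N L a).2 b

theorem wedgeBorder_mul_self (hL : 0 < L) (a : Form (N * L) L) :
    (wedgeBorder N L a : ExteriorAlgebra ℝ (Fin ((N + 1) * L) → ℝ)) * wedgeBorder N L a = 0 := by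
  have border_mul_self :
      (borderForm N L : ExteriorAlgebra ℝ (Fin ((N + 1) * L) → ℝ)) * borderForm N L = 0 := by
    rw [borderForm, coe_basicForm, ιMulti_mul_self hL]
  nth_rewrite 1 [coe_wedgeBorder]
  rw [mul_assoc, ← (commute_wedgeBorder a _).eq, coe_wedgeBorder, mul_assoc, border_mul_self,
    mul_zero, mul_zero]

theorem hyperpfaffian_extendForm_add_wedgeBorder {M : ℕ} (hL : 0 < L)
    (η : Form ((2 * M + 1) * L) (L + L)) (α : Form ((2 * M + 1) * L) L) :
    hyperpfaffian (extendForm (2 * M + 1) L η + wedgeBorder (2 * M + 1) L α) =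
      (M.factorial : ℝ)⁻¹ * volCoeff ((2 * M + 1) * L)
        ((α : ExteriorAlgebra ℝ (Fin ((2 * M + 1) * L) → ℝ)) *
          (η : ExteriorAlgebra ℝ (Fin ((2 * M + 1) * L) → ℝ)) ^ M) := by
  have degree : (2 * M + 1 + 1) * L / (L + L) = M + 1 := by
    rw [show (2 * M + 1 + 1) * L = (M + 1) * (L + L) by ring, Nat.mul_div_cancel _ (by omega)]
  have pow_succ_eq_zero : (η : ExteriorAlgebra ℝ (Fin ((2 * M + 1) * L) → ℝ)) ^ (M + 1) = 0 :=
    coe_pow_eq_zero_of_lt (by nlinarith) η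
  have mul_pow_mem : (α : ExteriorAlgebra ℝ (Fin ((2 * M + 1) * L) → ℝ)) * η ^ M ∈
      ⋀[ℝ]^((2 * M + 1) * L) (Fin ((2 * M + 1) * L) → ℝ) := by
    have := SetLike.mul_mem_graded (A := fun i : ℕ => ⋀[ℝ]^i (Fin ((2 * M + 1) * L) → ℝ))
      α.2 (coe_pow_mem_exteriorPower η M)
    rwa [show L + M * (L + L) = (2 * M + 1) * L by ring] at this
  have pow_mul_comm := (commute_of_mem_even ⟨L, rfl⟩ η.2
    (α : ExteriorAlgebra ℝ (Fin ((2 * M + 1) * L) → ℝ))).pow_left M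
  have pow_mul_wedgeBorder :
      ExteriorAlgebra.map (inclusion (2 * M + 1) L) η ^ M * wedgeBorder (2 * M + 1) L α =
        ExteriorAlgebra.map (inclusion (2 * M + 1) L) (α * η ^ M) * borderForm (2 * M + 1) L := by
    rw [coe_wedgeBorder, ← mul_assoc, ← map_pow, ← map_mul, pow_mul_comm.eq]
  rw [hyperpfaffian, degree, Submodule.coe_add, add_pow_succ_of_mul_self_eq_zero
      (commute_wedgeBorder α _).symm (wedgeBorder_mul_self hL α), coe_extendForm, ← map_pow,
    pow_succ_eq_zero, map_zero, zero_add, pow_mul_wedgeBorder, map_smul, map_nsmul,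
    volCoeff_map_mul_borderForm mul_pow_mem, Nat.factorial_succ]
  push_cast
  rw [smul_eq_mul, nsmul_eq_mul, Nat.cast_succ]
  field_simp

theorem hyperpfaffian_extendForm_doubleForm_add_wedgeBorder {M β : ℕ} (hL2 : Odd (L ^ 2))
    {ν : Measure ℝ} [SigmaFinite ν] {p : Fin ((2 * M + 1) * L) → Polynomial ℝ}
    (hp : IsCompleteMonic p) (hω : FormIntegrable ν (omega L p)) {k : ℝ → ℝ → ℝ}
    (hint : FormIntegrable (ν.prod ν) fun z => pairForm L p k z.1 z.2)
    (hk : ∀ x : Fin (2 * M + 1) → ℝ,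
      antisymmetrization (fun y => pairWeight k M (Fin.tail y)) x *
        (Matrix.vandermonde x).det ^ L ^ 2 =
          2 ^ M * M.factorial * |(Matrix.vandermonde x).det| ^ β) :
    hyperpfaffian (extendForm (2 * M + 1) L (doubleForm L p k ν) +
        wedgeBorder (2 * M + 1) L (formIntegral ν (omega L p))) =
      (partitionFunction (2 * M + 1) β ν).toReal := by
  have hL : 0 < L := Nat.pos_of_ne_zero fun h => by simp [h] at hL2
  rw [hyperpfaffian_extendForm_add_wedgeBorder hL,
    volCoeff_omega_mul_doubleForm_pow hL2 hp hω hint hk,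
    inv_mul_cancel_left₀ (Nat.cast_ne_zero.2 M.factorial_ne_zero)]

end Border

end HyperPf

end

theorem theorem1 (L N β : ℕ) (hL : 0 < L) (hN : 0 < N)
    (ν : MeasureTheory.Measure ℝ) [MeasureTheory.SigmaFinite ν]
    (hZpos : 0 < HyperPf.partitionFunction N β ν)
    (hZfin : HyperPf.partitionFunction N β ν < ⊤)
    (p : Fin (N * L) → Polynomial ℝ) (hp : HyperPf.IsCompleteMonic p) :
    (β = L ^ 2 → Even β →
      HyperPf.FormIntegrable ν (HyperPf.omega L p) ∧
      (HyperPf.partitionFunction N β ν).toReal =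
        HyperPf.hyperpfaffian (HyperPf.formIntegral ν (HyperPf.omega L p))) ∧
    (β = L ^ 2 → Odd β → Even N →
      HyperPf.FormIntegrable (ν.prod ν)
        (fun z => HyperPf.pairForm L p (fun x y => Real.sign (y - x)) z.1 z.2) ∧
      (HyperPf.partitionFunction N β ν).toReal =
        HyperPf.hyperpfaffian (HyperPf.doubleForm L p (fun x y => Real.sign (y - x)) ν)) ∧
    (β = L ^ 2 → Odd β → Odd N →
      HyperPf.FormIntegrable (ν.prod ν)
        (fun z => HyperPf.pairForm L p (fun x y => Real.sign (y - x)) z.1 z.2) ∧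
      HyperPf.FormIntegrable ν (fun x =>
        HyperPf.wedge (HyperPf.extendForm N L (HyperPf.omega L p x)) (HyperPf.borderForm N L)) ∧
      (HyperPf.partitionFunction N β ν).toReal =
        HyperPf.hyperpfaffian
          (HyperPf.extendForm N L (HyperPf.doubleForm L p (fun x y => Real.sign (y - x)) ν) +
            HyperPf.formIntegral ν fun x =>
              HyperPf.wedge (HyperPf.extendForm N L (HyperPf.omega L p x))
                (HyperPf.borderForm N L))) ∧
    (∀ M : ℕ, β = L ^ 2 + 1 → Even β → N = 2 * M →
      HyperPf.FormIntegrable (ν.prod ν)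
        (fun z => HyperPf.pairForm L p
          (fun x y => (y ^ M - x ^ M) ^ 2 / (y - x)) z.1 z.2) ∧
      (HyperPf.partitionFunction N β ν).toReal =
        HyperPf.hyperpfaffian (HyperPf.doubleForm L p
          (fun x y => (y ^ M - x ^ M) ^ 2 / (y - x)) ν)) := by
  refine ⟨?_, ?_, ?_, ?_⟩
  · rintro rfl hβ
    have hω := HyperPf.formIntegrable_omega hN hL hZpos hZfin hp
    exact ⟨hω, (HyperPf.hyperpfaffian_formIntegral_omega hL hβ hp hω).symm⟩
  · rintro rfl hβ hN_even
    obtain ⟨M, rfl⟩ := even_iff_exists_two_mul.1 hN_even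
    have hωω := HyperPf.formIntegrable_pairForm_sign hN hL hZpos hZfin hp
    exact ⟨hωω, (HyperPf.hyperpfaffian_doubleForm hβ hp hωω <|
      HyperPf.antisymmetrization_mul_det_vandermonde_pow hβ fun _ hx =>
        HyperPf.antisymmetrization_pairWeight_sign M hx).symm⟩
  · rintro rfl hβ ⟨M, rfl⟩
    have hω := HyperPf.formIntegrable_omega hN hL hZpos hZfin hp
    have hωω := HyperPf.formIntegrable_pairForm_sign hN hL hZpos hZfin hp
    have border := hω.hasWeakIntegral.map (HyperPf.wedgeBorder (2 * M + 1) L)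
    refine ⟨hωω, border.formIntegrable, Eq.symm ?_⟩
    refine (congrArg (fun B => HyperPf.hyperpfaffian (_ + B)) border.formIntegral_eq).trans ?_
    exact HyperPf.hyperpfaffian_extendForm_doubleForm_add_wedgeBorder hβ hp hω hωω <|
      HyperPf.antisymmetrization_mul_det_vandermonde_pow hβ fun _ hx =>
        HyperPf.antisymmetrization_pairWeight_sign_tail M hx
  · rintro M rfl hβ rfl
    have hL2 : Odd (L ^ 2) := Nat.not_even_iff_odd.1 (Nat.even_add_one.1 hβ)
    have hωω := HyperPf.formIntegrable_pairForm_sq_pow_sub_pow rfl hN hZpos hZfin hp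
    refine ⟨hωω, (HyperPf.hyperpfaffian_doubleForm hL2 hp hωω fun x => ?_).symm⟩
    rw [HyperPf.antisymmetrization_pairWeight_sq_pow_sub_pow, hβ.pow_abs, mul_assoc, ← pow_succ']
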